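/- Consider the system $x_{t+1}=Ax_t+Bu_t+\Xi w_t$ with $x_t\in\mathbb R^n$, $u_t\in\mathbb R^m$, $w_t\in\mathbb R^k$, weights $Q,Q_f\succeq 0$, $R\succ0$, and a horizon $T\ge1$. For each stage $t$ let $\nu_t=\frac1N\sum_{i=1}^N\delta_{\hat w_t^{(i)}}$ ($N\ge 1$) be an empirical distribution with mean $\bar w_t$. Let $\Pi$ be the set of Markov policies $\pi=(\pi_t)$ with $\pi_t:\mathbb R^n\to\mathbb R^m$ measurable, and $\Gamma$ the set of Markov opponent policies $\gamma=(\gamma_t)$, where $\gamma_t$ maps the state measurably to a Borel probability measure on $\mathbb R^k$. Under $(\pi,\gamma)$ one has $u_t=\pi_t(x_t)$, $\mu_t=\gamma_t(x_t)$ and $w_t\sim\mu_t$ given the past. Let $W_2$ be the Wasserstein distance of order $2$ for the Euclidean norm, and for $\lambda\ge0$, $\bm x\in\mathbb R^n$ put \[ J_{\bm x}(\pi,\gamma)=\frac1T\,\mathbb E^{\pi,\gamma}\Big[x_T^\top Q_fx_T+\sum_{t=0}^{T-1}\big(x_t^\top Qx_t+u_t^\top Ru_t\big)\,\Big|\,x_0=\bm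 x\Big], \] \[ J^\lambda_{\bm x}(\pi,\gamma)=\frac1T\,\mathbb E^{\pi,\gamma}\Big[x_T^\top Q_fx_T+\sum_{t=0}^{T-1}\big(x_t^\top Qx_t+u_t^\top Ru_t-\lambda W_2(\mu_t,\nu_t)^2\big)\,\Big|\,x_0=\bm x\Big], \] with values in $[-\infty,\infty]$ (an expectation whose positive and negative parts are both infinite is set to $-\infty$), and let $V(\bm x;\lambda)=\inf_{\pi\in\Pi}\sup_{\gamma\in\Gamma}J^\lambda_{\bm x}(\pi,\gamma)$. For $\theta\ge0$ let $\Gamma_{\mathcal D}$ be the set of $\gamma\in\Gamma$ with $W_2(\gamma_t(x),\nu_t)\le\theta$ for all $t$ and $x$. Theorem. (i) Let $\lambda\ge 0$ and $\bm x\in\mathbb R^n$. If $\pi^{\star,\lambda}\in\Pi$ is an optimal policy of the penalized problem from $\bm x$, i.e. minimizes $\sup_{\gamma\in\Gamma}J^\lambda_{\bm x}(\pi,\gamma)$ over $\pi\in\Pi$, then \[ \sup_{\gamma\in\Gamma_{\mathcal D}}J_{\bm x}(\pi^{\star,\lambda},\gamma)\le\lambda\theta^2+V(\bm x;\lambda).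 \] (ii) Let $\lambda>0$, $\Phi=BR^{-1}B^\top-\frac1\lambda\Xi\Xi^\top$, $P_T=Q_f$, $r_T=0$, and for $t<T$ \[ P_t=Q+A^\top(I+P_{t+1}\Phi)^{-1}P_{t+1}A,\qquad r_t=A^\top(I+P_{t+1}\Phi)^{-1}(P_{t+1}\Xi\bar w_t+r_{t+1}). \] If $\lambda I-\Xi^\top P_t\Xi\succ0$ for $t=1,\dots,T$, then the affine policy $\pi^{\star,\lambda}_t(x)=K_tx+L_t$, where \[ K_t=-R^{-1}B^\top(I+P_{t+1}\Phi)^{-1}P_{t+1}A,\qquad L_t=-R^{-1}B^\top(I+P_{t+1}\Phi)^{-1}(P_{t+1}\Xi\bar w_t+r_{t+1}), \] is optimal for the penalized problem from every $\bm x\in\mathbb R^n$, and hence satisfies the inequality of (i) for every $\bm x\in\mathbb R^n$. -/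

import Mathlib

open MeasureTheory ProbabilityTheory Matrix
open scoped ENNReal

noncomputable section

namespace WassersteinControl

/-- The Wasserstein distance of order `2` on `ℝ^k` (Euclidean norm), with values in `[0, ∞]`:
the infimum of `(∫ ‖x - y‖² dη)^{1/2}` over all couplings `η` of `μ` and `ν`. -/
def wasserstein2 {k : ℕ} (μ ν : Measure (EuclideanSpace ℝ (Fin k))) : ℝ≥0∞ :=
  ⨅ (η : Measure (EuclideanSpace ℝ (Fin k) × EuclideanSpace ℝ (Fin k)))
    (_ : η.fst = μ ∧ η.snd = ν), (∫⁻ p, ‖p.1 - p.2‖ₑ ^ 2 ∂η) ^ (1 / 2 : ℝ)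

/-- Expectation of an extended-real random variable, `E[f⁺] - E[f⁻]`. In the undefined case
`∞ - ∞` the value is `-∞`. -/
def extExpectation {Ω : Type*} [MeasurableSpace Ω] (P : Measure Ω) (f : Ω → EReal) : EReal :=
  ((∫⁻ ω, (f ω).toENNReal ∂P : ℝ≥0∞) : EReal) - ((∫⁻ ω, (-f ω).toENNReal ∂P : ℝ≥0∞) : EReal)

/-- Deterministic Markov control policies: sequences of measurable maps from state to input. -/
structure Policy (n m : ℕ) where
  /-- the input `u_t = act t x_t` -/
  act : ℕ → (Fin n → ℝ) → (Fin m → ℝ)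
  measurable_act : ∀ t, Measurable (act t)

/-- Deterministic Markov opponent policies: at each stage, the current state is mapped measurably
to a probability distribution of the disturbance, i.e. `dist t` is a Markov kernel. -/
structure Opponent (n k : ℕ) where
  /-- the disturbance distribution `μ_t = dist t x_t` -/
  dist : ℕ → Kernel (Fin n → ℝ) (EuclideanSpace ℝ (Fin k))
  isMarkov : ∀ t, IsMarkovKernel (dist t)

/-- Data of the control problem: system `x_{t+1} = A x_t + B u_t + Ξ w_t`, weights `Q`, `Q_f`, `R`,
horizon `T` and, for each stage `t`, the `N` samples `sample t i` of `w_t`. -/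
structure Problem (n m k N : ℕ) where
  A : Matrix (Fin n) (Fin n) ℝ
  B : Matrix (Fin n) (Fin m) ℝ
  Xi : Matrix (Fin n) (Fin k) ℝ
  Q : Matrix (Fin n) (Fin n) ℝ
  Qf : Matrix (Fin n) (Fin n) ℝ
  R : Matrix (Fin m) (Fin m) ℝ
  T : ℕ
  sample : ℕ → Fin N → EuclideanSpace ℝ (Fin k)

namespace Problem

variable {n m k N : ℕ} (S : Problem n m k N)

/-- The empirical distribution `ν_t = (1/N) ∑ᵢ δ_{ŵ_t^{(i)}}`. -/
def empirical (t : ℕ) : Measure (EuclideanSpace ℝ (Fin k)) :=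
  (N : ℝ≥0∞)⁻¹ • ∑ i, Measure.dirac (S.sample t i)

/-- The next state `A x + B u_t + Ξ w`, where `u_t = π_t(x)`. -/
def next (π : Policy n m) (t : ℕ) (x : Fin n → ℝ) (w : EuclideanSpace ℝ (Fin k)) : Fin n → ℝ :=
  S.A *ᵥ x + S.B *ᵥ π.act t x + S.Xi *ᵥ w.ofLp

lemma measurable_mulVec {p q : ℕ} (M : Matrix (Fin p) (Fin q) ℝ) :
    Measurable fun v : Fin q → ℝ => M *ᵥ v :=
  (Continuous.matrix_mulVec continuous_const continuous_id).measurable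

lemma measurable_next (π : Policy n m) (t : ℕ) :
    Measurable fun p : (Fin n → ℝ) × EuclideanSpace ℝ (Fin k) => S.next π t p.1 p.2 := by
  have h : Measurable fun w : EuclideanSpace ℝ (Fin k) => w.ofLp :=
    (PiLp.continuous_ofLp 2 _).measurable
  exact (((measurable_mulVec S.A).comp measurable_fst).add
    ((measurable_mulVec S.B).comp ((π.measurable_act t).comp measurable_fst))).add
    ((measurable_mulVec S.Xi).comp (h.comp measurable_snd))

/-- Transition kernel of the state at stage `t`: given `x_t = x`, the law of
`A x + B π_t(x) + Ξ w` with `w ∼ γ_t(x)`. -/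
def step (π : Policy n m) (γ : Opponent n k) (t : ℕ) : Kernel (Fin n → ℝ) (Fin n → ℝ) :=
  (Kernel.id ×ₖ γ.dist t).map fun p => S.next π t p.1 p.2

/-- The same transition kernel, seen as a kernel from histories `(x_0, …, x_t)`. -/
def historyStep (π : Policy n m) (γ : Opponent n k) (t : ℕ) :
    Kernel (Finset.Iic t → Fin n → ℝ) (Fin n → ℝ) :=
  (S.step π γ t).comap (fun h => h ⟨t, Finset.mem_Iic.2 le_rfl⟩) (measurable_pi_apply _)

instance (π : Policy n m) (γ : Opponent n k) (t : ℕ) : IsMarkovKernel (S.step π γ t) := by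
  have := γ.isMarkov t
  exact Kernel.IsMarkovKernel.map _ (S.measurable_next π t)

instance (π : Policy n m) (γ : Opponent n k) (t : ℕ) : IsMarkovKernel (S.historyStep π γ t) := by
  unfold historyStep; infer_instance

/-- The law of the state trajectory `(x_0, x_1, …)` under `(π, γ)` given `x_0 = x`. -/
def law (π : Policy n m) (γ : Opponent n k) (x : Fin n → ℝ) : Measure (ℕ → Fin n → ℝ) :=
  Kernel.traj (X := fun _ => Fin n → ℝ) (S.historyStep π γ) 0 (fun _ => x)

/-- The stage cost `xᵀ Q x + uᵀ R u`. -/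
def stageCost (x : Fin n → ℝ) (u : Fin m → ℝ) : ℝ :=
  x ⬝ᵥ S.Q *ᵥ x + u ⬝ᵥ S.R *ᵥ u

/-- `J_x(π, γ)`: the standard quadratic cost, averaged over the horizon. -/
def cost (x : Fin n → ℝ) (π : Policy n m) (γ : Opponent n k) : EReal :=
  (((S.T : ℝ)⁻¹ : ℝ) : EReal) * extExpectation (S.law π γ x) fun ξ =>
    ((ξ S.T ⬝ᵥ S.Qf *ᵥ ξ S.T : ℝ) : EReal) +
      ∑ t ∈ Finset.range S.T, ((S.stageCost (ξ t) (π.act t (ξ t)) : ℝ) : EReal)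

/-- `J_x^lam(π, γ)`: the cost with the Wasserstein penalty `lam * W₂(μ_t, ν_t)²`. -/
def penalizedCost (lam : ℝ) (x : Fin n → ℝ) (π : Policy n m) (γ : Opponent n k) : EReal :=
  (((S.T : ℝ)⁻¹ : ℝ) : EReal) * extExpectation (S.law π γ x) fun ξ =>
    ((ξ S.T ⬝ᵥ S.Qf *ᵥ ξ S.T : ℝ) : EReal) +
      ∑ t ∈ Finset.range S.T, (((S.stageCost (ξ t) (π.act t (ξ t)) : ℝ) : EReal) -
        (lam : EReal) * ((wasserstein2 (γ.dist t (ξ t)) (S.empirical t) ^ 2 : ℝ≥0∞) : EReal))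

/-- The optimal value `V(x; lam) = inf_π sup_γ J_x^lam(π, γ)`. -/
def value (lam : ℝ) (x : Fin n → ℝ) : EReal :=
  ⨅ π : Policy n m, ⨆ γ : Opponent n k, S.penalizedCost lam x π γ

/-- `π` solves `min_π sup_γ J_x^lam(π, γ)` for the initial state `x`. -/
def IsOptimal (lam : ℝ) (x : Fin n → ℝ) (π : Policy n m) : Prop :=
  ∀ π' : Policy n m,
    (⨆ γ : Opponent n k, S.penalizedCost lam x π γ) ≤ ⨆ γ : Opponent n k, S.penalizedCost lam x π' γ

/-- Opponent policies all of whose distributions lie in the Wasserstein balls of radius `θ`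
around the empirical distributions. -/
def ambiguity (θ : ℝ) : Set (Opponent n k) :=
  {γ | ∀ t x, wasserstein2 (γ.dist t x) (S.empirical t) ≤ ENNReal.ofReal θ}

/-- `Φ = B R⁻¹ Bᵀ - (1/lam) Ξ Ξᵀ`. -/
def Phi (lam : ℝ) : Matrix (Fin n) (Fin n) ℝ :=
  S.B * S.R⁻¹ * S.Bᵀ - (1 / lam) • (S.Xi * S.Xiᵀ)

/-- The mean `w̄_t` of the empirical distribution. -/
def mean (t : ℕ) : EuclideanSpace ℝ (Fin k) := ∫ w, w ∂S.empirical t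

/-- The backward Riccati recursion, by the number `j` of remaining stages:
`riccati lam j = (P_{T-j}, r_{T-j})`. -/
def riccati (lam : ℝ) : ℕ → Matrix (Fin n) (Fin n) ℝ × (Fin n → ℝ)
  | 0 => (S.Qf, 0)
  | j + 1 =>
    let P := (riccati lam j).1
    let r := (riccati lam j).2
    (S.Q + S.Aᵀ * (1 + P * S.Phi lam)⁻¹ * P * S.A,
      S.Aᵀ *ᵥ ((1 + P * S.Phi lam)⁻¹ *ᵥ ((P * S.Xi) *ᵥ (S.mean (S.T - (j + 1))).ofLp + r)))

/-- The Riccati matrices `P_t`, for `t ≤ T`. -/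
def P (lam : ℝ) (t : ℕ) : Matrix (Fin n) (Fin n) ℝ := (S.riccati lam (S.T - t)).1

/-- The vectors `r_t`, for `t ≤ T`. -/
def r (lam : ℝ) (t : ℕ) : Fin n → ℝ := (S.riccati lam (S.T - t)).2

/-- The penalty parameter exceeds every eigenvalue of `Ξᵀ P_t Ξ`, for `t = 1, …, T`. -/
def PenaltyCondition (lam : ℝ) : Prop :=
  ∀ t, 1 ≤ t → t ≤ S.T → (lam • (1 : Matrix (Fin k) (Fin k) ℝ) - S.Xiᵀ * S.P lam t * S.Xi).PosDef

/-- `K_t = -R⁻¹ Bᵀ (I + P_{t+1} Φ)⁻¹ P_{t+1} A`. -/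
def gain (lam : ℝ) (t : ℕ) : Matrix (Fin m) (Fin n) ℝ :=
  -(S.R⁻¹ * S.Bᵀ * (1 + S.P lam (t + 1) * S.Phi lam)⁻¹ * S.P lam (t + 1) * S.A)

/-- `L_t = -R⁻¹ Bᵀ (I + P_{t+1} Φ)⁻¹ (P_{t+1} Ξ w̄_t + r_{t+1})`. -/
def offset (lam : ℝ) (t : ℕ) : Fin m → ℝ :=
  -((S.R⁻¹ * S.Bᵀ * (1 + S.P lam (t + 1) * S.Phi lam)⁻¹) *ᵥ
    ((S.P lam (t + 1) * S.Xi) *ᵥ (S.mean t).ofLp + S.r lam (t + 1)))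

/-- The policy `x ↦ K_t x + L_t`. (Only the stages `t < T` enter the cost.) -/
def riccatiPolicy (lam : ℝ) : Policy n m where
  act t x := S.gain lam t *ᵥ x + S.offset lam t
  measurable_act t := (measurable_mulVec (S.gain lam t)).add_const _

end Problem

end WassersteinControl

end

/-! Part (i) is the easy direction of Lagrangian duality. An opponent in the Wasserstein balls pays
a penalty of at most `λθ²` per stage, so `J ≤ λθ² + J^λ` against it. Enlarging the balls to all
opponents gives a supremum that optimality of the policy bounds by `V` (`cost_le_penalizedCost`,
`iSup_cost_le`).

Part (ii) is a verification argument with `v_t(x) = xᵀP_t x + 2r_tᵀx + s_t`. The game of one stage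
has an explicit saddle point: the Riccati input, and the displacement of each sample `ŵ` to the
stationary point of `v_{t+1}(x_{t+1}) - λ‖w - ŵ‖²`. This function is concave in `w` since `λI - ΞᵀPΞ
≻ 0`, so the displacement is a best response sample by sample, and integration over a coupling
bounds the gain of every distribution (`le_saddleTerm`, `stage_upper`). In the input the cost is
convex since `P ⪰ 0` and `R ≻ 0`, and its first-order terms vanish on average over the samples
(`saddleTerm_le`, `stage_lower`). The averaged saddle value is `v_t` (`saddle_value`).

Summed over the stages, these bounds compare the total cost with `v_0(x_0)` plus compensated
increments, whose expectation is `v_0(x)` (`integral_compensated`). Hence the Riccati policy costs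
at most `v_0(x)/T` against every opponent, and every policy costs at least `v_0(x)/T` against the
worst-case opponent. Neither a minimax theorem nor measurable selection is needed.

The delicate point is integrability. Missing second moments make the penalty infinite, and an
infinite negative part makes the expectation `-∞`; otherwise an integrable negative part already
forces the compensated sum to be integrable. Against the worst-case opponent all state laws have
finite support. -/

noncomputable section

/-! ### Quadratic forms and well-posedness of the Riccati step -/

namespace WassersteinControl

/-- The quadratic function `z ↦ zᵀ P z + 2 rᵀ z + s`. -/
def quad {n : ℕ} (P : Matrix (Fin n) (Fin n) ℝ) (r : Fin n → ℝ) (s : ℝ) (z : Fin n → ℝ) : ℝ :=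
  z ⬝ᵥ P *ᵥ z + 2 * (r ⬝ᵥ z) + s

lemma dotProduct_mulVec_transpose {p q : ℕ} (M : Matrix (Fin p) (Fin q) ℝ) (v : Fin p → ℝ)
    (w : Fin q → ℝ) : v ⬝ᵥ M *ᵥ w = w ⬝ᵥ Mᵀ *ᵥ v := by
  rw [dotProduct_mulVec, mulVec_transpose, dotProduct_comm]

lemma PosSemidef.transpose_eq {p : ℕ} {M : Matrix (Fin p) (Fin p) ℝ} (h : M.PosSemidef) :
    Mᵀ = M := by
  simpa [IsHermitian, conjTranspose_eq_transpose_of_trivial] using h.1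

lemma PosDef.transpose_eq {p : ℕ} {M : Matrix (Fin p) (Fin p) ℝ} (h : M.PosDef) : Mᵀ = M :=
  PosSemidef.transpose_eq h.posSemidef

lemma PosSemidef.dot_nonneg {p : ℕ} {M : Matrix (Fin p) (Fin p) ℝ} (h : M.PosSemidef)
    (v : Fin p → ℝ) : 0 ≤ v ⬝ᵥ M *ᵥ v := by
  simpa using h.dotProduct_mulVec_nonneg v

lemma PosDef.eq_zero {p : ℕ} {M : Matrix (Fin p) (Fin p) ℝ} (h : M.PosDef)
    {v : Fin p → ℝ} (hv : v ⬝ᵥ M *ᵥ v ≤ 0) : v = 0 := by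
  by_contra hne
  have := h.dotProduct_mulVec_pos hne
  simp only [star_trivial] at this
  linarith

lemma dot_mulVec_add {p : ℕ} {M : Matrix (Fin p) (Fin p) ℝ} (h : Mᵀ = M)
    (v d : Fin p → ℝ) :
    (v + d) ⬝ᵥ M *ᵥ (v + d) = v ⬝ᵥ M *ᵥ v + 2 * (d ⬝ᵥ M *ᵥ v) + d ⬝ᵥ M *ᵥ d := by
  have := dotProduct_mulVec_transpose M v d
  rw [h] at this
  simp only [mulVec_add, dotProduct_add, add_dotProduct]
  linarith

lemma dot_self_add {p : ℕ} (v d : Fin p → ℝ) :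
    (v + d) ⬝ᵥ (v + d) = v ⬝ᵥ v + 2 * (d ⬝ᵥ v) + d ⬝ᵥ d := by
  simp only [dotProduct_add, add_dotProduct, dotProduct_comm v d]
  ring

lemma quad_add {n : ℕ} {P : Matrix (Fin n) (Fin n) ℝ} (h : Pᵀ = P) (r : Fin n → ℝ) (s : ℝ)
    (z d : Fin n → ℝ) :
    quad P r s (z + d) = quad P r s z + 2 * (d ⬝ᵥ (P *ᵥ z + r)) + d ⬝ᵥ P *ᵥ d := by
  unfold quad
  rw [dot_mulVec_add h, dotProduct_add, dotProduct_add, dotProduct_comm r d]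
  ring

namespace Problem

variable {n m k N : ℕ} (S : Problem n m k N)

/-- `Φ` is input energy minus disturbance energy: a costate `g` induces the input `-R⁻¹Bᵀg` and the
mean disturbance shift `(1/λ)Ξᵀg`. -/
lemma dot_Phi (hR : S.R.PosDef) (lam : ℝ) (g : Fin n → ℝ) (h : Fin n → ℝ) :
    h ⬝ᵥ S.Phi lam *ᵥ g = (S.R⁻¹ *ᵥ S.Bᵀ *ᵥ h) ⬝ᵥ S.R *ᵥ (S.R⁻¹ *ᵥ S.Bᵀ *ᵥ g) -
      1 / lam * ((S.Xiᵀ *ᵥ h) ⬝ᵥ (S.Xiᵀ *ᵥ g)) := by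
  have hdet : IsUnit S.R.det := (isUnit_iff_isUnit_det _).1 hR.isUnit
  have hRi : (S.R⁻¹)ᵀ = S.R⁻¹ := by rw [transpose_nonsing_inv, PosDef.transpose_eq hR]
  have e1 : S.R *ᵥ (S.R⁻¹ *ᵥ S.Bᵀ *ᵥ g) = S.Bᵀ *ᵥ g := by
    rw [mulVec_mulVec, mul_nonsing_inv _ hdet, one_mulVec]
  rw [e1, Phi, sub_mulVec, dotProduct_sub, smul_mulVec, dotProduct_smul, smul_eq_mul]
  congr 1
  · rw [← mulVec_mulVec, ← mulVec_mulVec, dotProduct_mulVec_transpose,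
      dotProduct_comm (S.R⁻¹ *ᵥ S.Bᵀ *ᵥ h), dotProduct_mulVec_transpose S.R⁻¹ (S.Bᵀ *ᵥ g), hRi,
      dotProduct_comm (S.R⁻¹ *ᵥ S.Bᵀ *ᵥ g),
      dotProduct_mulVec_transpose S.R⁻¹, hRi, dotProduct_comm]
  · rw [← mulVec_mulVec, dotProduct_mulVec_transpose, dotProduct_comm]

/-- Completion of the square behind invertibility and positivity in the Riccati step. -/
lemma riccati_identity (hR : S.R.PosDef) {lam : ℝ} (hlam : 0 < lam)
    {P : Matrix (Fin n) (Fin n) ℝ} (hP : Pᵀ = P) (z : Fin n → ℝ) :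
    (z + S.Phi lam *ᵥ P *ᵥ z) ⬝ᵥ P *ᵥ z =
      (z - S.Xi *ᵥ ((1 / lam) • S.Xiᵀ *ᵥ P *ᵥ z)) ⬝ᵥ
          P *ᵥ (z - S.Xi *ᵥ ((1 / lam) • S.Xiᵀ *ᵥ P *ᵥ z)) +
        ((1 / lam) • S.Xiᵀ *ᵥ P *ᵥ z) ⬝ᵥ
          (lam • (1 : Matrix (Fin k) (Fin k) ℝ) - S.Xiᵀ * P * S.Xi) *ᵥ
            ((1 / lam) • S.Xiᵀ *ᵥ P *ᵥ z) +
        (S.R⁻¹ *ᵥ S.Bᵀ *ᵥ P *ᵥ z) ⬝ᵥ S.R *ᵥ (S.R⁻¹ *ᵥ S.Bᵀ *ᵥ P *ᵥ z) := by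
  set w := (1 / lam) • S.Xiᵀ *ᵥ P *ᵥ z with hw
  have hw' : S.Xiᵀ *ᵥ P *ᵥ z = lam • w := by
    rw [hw, smul_smul, mul_one_div_cancel hlam.ne', one_smul]
  rw [add_dotProduct, dotProduct_comm (S.Phi lam *ᵥ P *ᵥ z), dot_Phi S hR, hw', sub_eq_add_neg z,
    ← mulVec_neg, dot_mulVec_add hP, sub_mulVec, smul_mulVec, one_mulVec, ← mulVec_mulVec,
    ← mulVec_mulVec, dotProduct_sub, ← dotProduct_mulVec_transpose]
  have h1 : (S.Xi *ᵥ (-w)) ⬝ᵥ P *ᵥ z = -(lam * (w ⬝ᵥ w)) := by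
    rw [dotProduct_comm, dotProduct_mulVec_transpose, hw', dotProduct_smul, neg_dotProduct]
    simp
  have h2 : w ⬝ᵥ S.Xiᵀ *ᵥ P *ᵥ S.Xi *ᵥ w = (S.Xi *ᵥ w) ⬝ᵥ P *ᵥ S.Xi *ᵥ w := by
    rw [← dotProduct_mulVec_transpose, dotProduct_comm]
  rw [h1]
  simp only [mulVec_neg, neg_dotProduct, dotProduct_neg, dotProduct_smul, smul_dotProduct,
    smul_eq_mul]
  rw [dotProduct_comm (P *ᵥ S.Xi *ᵥ w)]
  field_simp
  ring

/-- A kernel vector `g` equals `Pz` with `z = -Φg`, which makes the left side of `riccati_identity`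
zero. Its three nonnegative terms then vanish; definiteness of `λI - ΞᵀPΞ` and of `R` kills both
parts of `Φg`, so `z = 0` and `g = 0`. -/
lemma isUnit_one_add_mul_Phi (hR : S.R.PosDef) {lam : ℝ} (hlam : 0 < lam)
    {P : Matrix (Fin n) (Fin n) ℝ} (hP : P.PosSemidef)
    (hD : (lam • (1 : Matrix (Fin k) (Fin k) ℝ) - S.Xiᵀ * P * S.Xi).PosDef) :
    IsUnit (1 + P * S.Phi lam).det := by
  rw [isUnit_iff_ne_zero]
  intro hdet
  obtain ⟨g, hg0, hg⟩ := exists_mulVec_eq_zero_iff.2 hdet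
  apply hg0
  have hPt := PosSemidef.transpose_eq hP
  set z := -(S.Phi lam *ᵥ g) with hz
  have hgz : P *ᵥ z = g := by
    rw [add_mulVec, one_mulVec, ← mulVec_mulVec] at hg
    rw [hz, mulVec_neg]
    exact (eq_neg_of_add_eq_zero_left hg).symm
  have key := S.riccati_identity hR hlam hPt z
  have h1 := PosSemidef.dot_nonneg hP (z - S.Xi *ᵥ ((1 / lam) • S.Xiᵀ *ᵥ P *ᵥ z))
  have h2 := PosSemidef.dot_nonneg hD.posSemidef ((1 / lam) • S.Xiᵀ *ᵥ P *ᵥ z)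
  have h3 := PosSemidef.dot_nonneg hR.posSemidef (S.R⁻¹ *ᵥ S.Bᵀ *ᵥ P *ᵥ z)
  rw [hgz] at key h1 h2 h3
  have h0 : z + S.Phi lam *ᵥ g = 0 := by rw [hz]; simp
  rw [h0, zero_dotProduct] at key
  have hw := PosDef.eq_zero hD (v := (1 / lam) • S.Xiᵀ *ᵥ g) (by linarith)
  have hu := PosDef.eq_zero hR (v := S.R⁻¹ *ᵥ S.Bᵀ *ᵥ g) (by linarith)
  have hPhi : S.Phi lam *ᵥ g = 0 := by
    rw [Phi, sub_mulVec, smul_mulVec, ← mulVec_mulVec, ← mulVec_mulVec, ← mulVec_mulVec, hu,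
      ← mulVec_smul, hw]
    simp
  rw [← hgz, hz, hPhi]
  simp

lemma Phi_transpose (hR : S.R.PosDef) (lam : ℝ) : (S.Phi lam)ᵀ = S.Phi lam := by
  simp [Phi, transpose_nonsing_inv, PosDef.transpose_eq hR, Matrix.mul_assoc]

/-- Push-through identity: `P(I + ΦP) = (I + PΦ)P`. -/
lemma inv_mul_transpose (hR : S.R.PosDef) (lam : ℝ) {P : Matrix (Fin n) (Fin n) ℝ} (hP : Pᵀ = P)
    (hu : IsUnit (1 + P * S.Phi lam).det) :
    ((1 + P * S.Phi lam)⁻¹ * P)ᵀ = (1 + P * S.Phi lam)⁻¹ * P := by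
  have ht : (1 + P * S.Phi lam)ᵀ = 1 + S.Phi lam * P := by
    simp [hP, S.Phi_transpose hR]
  have hu' : IsUnit (1 + S.Phi lam * P).det := by rw [← ht, det_transpose]; exact hu
  rw [transpose_mul, hP, transpose_nonsing_inv, ht]
  have h : P * (1 + S.Phi lam * P) = (1 + P * S.Phi lam) * P := by
    simp [mul_add, add_mul, Matrix.mul_assoc]
  calc P * (1 + S.Phi lam * P)⁻¹
      = (1 + P * S.Phi lam)⁻¹ * ((1 + P * S.Phi lam) * P) * (1 + S.Phi lam * P)⁻¹ := by
        rw [← Matrix.mul_assoc, nonsing_inv_mul _ hu, Matrix.one_mul]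
    _ = _ := by
        rw [← h, Matrix.mul_assoc, Matrix.mul_assoc, mul_nonsing_inv _ hu', Matrix.mul_one]

/-- With `g = (I + PΦ)⁻¹Pb` and `z = b - Φg` one has `g = Pz` and `b = z + ΦPz`, so
`riccati_identity` writes `bᵀ(I + PΦ)⁻¹Pb` as a sum of nonnegative terms. Congruence by `A`
preserves this. -/
lemma posSemidef_riccati_step (hQ : S.Q.PosSemidef) (hR : S.R.PosDef) {lam : ℝ} (hlam : 0 < lam)
    {P : Matrix (Fin n) (Fin n) ℝ} (hP : P.PosSemidef)
    (hD : (lam • (1 : Matrix (Fin k) (Fin k) ℝ) - S.Xiᵀ * P * S.Xi).PosDef) :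
    (S.Q + S.Aᵀ * (1 + P * S.Phi lam)⁻¹ * P * S.A).PosSemidef := by
  have hu := S.isUnit_one_add_mul_Phi hR hlam hP hD
  have hPt := PosSemidef.transpose_eq hP
  have hMt := S.inv_mul_transpose hR lam hPt hu
  refine hQ.add ?_
  have hM : ((1 + P * S.Phi lam)⁻¹ * P).PosSemidef := by
    refine PosSemidef.of_dotProduct_mulVec_nonneg ?_ fun b => ?_
    · rw [IsHermitian, conjTranspose_eq_transpose_of_trivial, hMt]
    · set g := (1 + P * S.Phi lam)⁻¹ *ᵥ P *ᵥ b with hg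
      have hgb : g + P *ᵥ S.Phi lam *ᵥ g = P *ᵥ b := by
        have : (1 + P * S.Phi lam) *ᵥ g = P *ᵥ b := by
          rw [hg, mulVec_mulVec, mul_nonsing_inv _ hu, one_mulVec]
        rwa [add_mulVec, one_mulVec, ← mulVec_mulVec] at this
      set z := b - S.Phi lam *ᵥ g with hz
      have hgz : P *ᵥ z = g := by rw [hz, mulVec_sub, ← hgb]; simp
      have key := S.riccati_identity hR hlam hPt z
      have h1 := PosSemidef.dot_nonneg hP (z - S.Xi *ᵥ ((1 / lam) • S.Xiᵀ *ᵥ P *ᵥ z))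
      have h2 := PosSemidef.dot_nonneg hD.posSemidef ((1 / lam) • S.Xiᵀ *ᵥ P *ᵥ z)
      have h3 := PosSemidef.dot_nonneg hR.posSemidef (S.R⁻¹ *ᵥ S.Bᵀ *ᵥ P *ᵥ z)
      have hb : z + S.Phi lam *ᵥ P *ᵥ z = b := by rw [hgz, hz]; simp
      rw [hb] at key
      rw [star_trivial, ← mulVec_mulVec, ← hg, ← hgz, key]
      linarith
  have := hM.conjTranspose_mul_mul_same S.A
  rwa [conjTranspose_eq_transpose_of_trivial, ← Matrix.mul_assoc] at this

end Problem
end WassersteinControl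
end

/-! ### The saddle point of one stage -/

noncomputable section

namespace WassersteinControl
namespace Problem

variable {n m k N : ℕ} (S : Problem n m k N)

/-- Half the gradient of the next value function at the mean next state of the saddle point. -/
def costate (lam : ℝ) (P : Matrix (Fin n) (Fin n) ℝ) (r : Fin n → ℝ) (wb : Fin k → ℝ)
    (x : Fin n → ℝ) : Fin n → ℝ :=
  (1 + P * S.Phi lam)⁻¹ *ᵥ (P *ᵥ (S.A *ᵥ x + S.Xi *ᵥ wb) + r)

/-- The minimizing input of the saddle point. -/
def saddleInput (lam : ℝ) (P : Matrix (Fin n) (Fin n) ℝ) (r : Fin n → ℝ) (wb : Fin k → ℝ)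
    (x : Fin n → ℝ) : Fin m → ℝ :=
  -(S.R⁻¹ *ᵥ S.Bᵀ *ᵥ S.costate lam P r wb x)

/-- Deviation of the worst-case disturbance from its mean. -/
def spread (lam : ℝ) (P : Matrix (Fin n) (Fin n) ℝ) (wb w : Fin k → ℝ) : Fin k → ℝ :=
  lam • (lam • (1 : Matrix (Fin k) (Fin k) ℝ) - S.Xiᵀ * P * S.Xi)⁻¹ *ᵥ (w - wb)

/-- The maximizing displacement of the sample `w` at the saddle point. -/
def saddleDisturbance (lam : ℝ) (P : Matrix (Fin n) (Fin n) ℝ) (r : Fin n → ℝ)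
    (wb : Fin k → ℝ) (x : Fin n → ℝ) (w : Fin k → ℝ) : Fin k → ℝ :=
  wb + (1 / lam) • S.Xiᵀ *ᵥ S.costate lam P r wb x + S.spread lam P wb w

/-- The next state at the saddle point, when the sample is `w`. -/
def saddleNext (lam : ℝ) (P : Matrix (Fin n) (Fin n) ℝ) (r : Fin n → ℝ)
    (wb : Fin k → ℝ) (x : Fin n → ℝ) (w : Fin k → ℝ) : Fin n → ℝ :=
  S.A *ᵥ x + S.B *ᵥ S.saddleInput lam P r wb x + S.Xi *ᵥ S.saddleDisturbance lam P r wb x w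

/-- The worst-case value of `v(x_{t+1}) - lam ‖w_t - w‖²` for the saddle point input. -/
def saddleTerm (lam : ℝ) (P : Matrix (Fin n) (Fin n) ℝ) (r : Fin n → ℝ) (s : ℝ)
    (wb : Fin k → ℝ) (x : Fin n → ℝ) (w : Fin k → ℝ) : ℝ :=
  quad P r s (S.saddleNext lam P r wb x w) -
    lam * ((S.saddleDisturbance lam P r wb x w - w) ⬝ᵥ (S.saddleDisturbance lam P r wb x w - w))

section
variable {S} {lam : ℝ} {P : Matrix (Fin n) (Fin n) ℝ} {r : Fin n → ℝ} {s : ℝ} {wb : Fin k → ℝ}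

lemma R_mulVec_saddleInput (hR : S.R.PosDef) (x : Fin n → ℝ) :
    S.R *ᵥ S.saddleInput lam P r wb x = -(S.Bᵀ *ᵥ S.costate lam P r wb x) := by
  have hdet : IsUnit S.R.det := (isUnit_iff_isUnit_det _).1 hR.isUnit
  rw [saddleInput, mulVec_neg, mulVec_mulVec, mul_nonsing_inv _ hdet, one_mulVec]

/-- The input and the mean shift of the disturbance combine into `-Φg`, so the sample enters only
through its spread. -/
lemma saddleNext_eq (x : Fin n → ℝ) (w : Fin k → ℝ) :
    S.saddleNext lam P r wb x w = (S.A *ᵥ x + S.Xi *ᵥ wb -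
      S.Phi lam *ᵥ S.costate lam P r wb x) + S.Xi *ᵥ S.spread lam P wb w := by
  rw [saddleNext, saddleInput, saddleDisturbance, Phi, sub_mulVec, smul_mulVec, mulVec_add,
    mulVec_add, mulVec_smul, mulVec_neg]
  simp only [← mulVec_mulVec]
  abel

lemma costate_eq (hu : IsUnit (1 + P * S.Phi lam).det) (x : Fin n → ℝ) :
    P *ᵥ (S.A *ᵥ x + S.Xi *ᵥ wb - S.Phi lam *ᵥ S.costate lam P r wb x) + r =
      S.costate lam P r wb x := by
  have : (1 + P * S.Phi lam) *ᵥ S.costate lam P r wb x = P *ᵥ (S.A *ᵥ x + S.Xi *ᵥ wb) + r := by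
    rw [costate, mulVec_mulVec, mul_nonsing_inv _ hu, one_mulVec]
  rw [add_mulVec, one_mulVec, ← mulVec_mulVec] at this
  rw [mulVec_sub, sub_add_eq_add_sub, ← this, add_sub_cancel_right]

lemma gradient_saddleNext (hu : IsUnit (1 + P * S.Phi lam).det)
    (x : Fin n → ℝ) (w : Fin k → ℝ) :
    P *ᵥ S.saddleNext lam P r wb x w + r =
      S.costate lam P r wb x + P *ᵥ S.Xi *ᵥ S.spread lam P wb w := by
  conv_rhs => rw [← costate_eq hu]
  rw [saddleNext_eq, mulVec_add]
  abel

lemma spread_eq (hD : (lam • (1 : Matrix (Fin k) (Fin k) ℝ) - S.Xiᵀ * P * S.Xi).PosDef)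
    (w : Fin k → ℝ) :
    S.Xiᵀ *ᵥ P *ᵥ S.Xi *ᵥ S.spread lam P wb w = lam • (S.spread lam P wb w - (w - wb)) := by
  have hdet := (isUnit_iff_isUnit_det _).1 hD.isUnit
  have : (lam • (1 : Matrix (Fin k) (Fin k) ℝ) - S.Xiᵀ * P * S.Xi) *ᵥ S.spread lam P wb w =
      lam • (w - wb) := by
    rw [spread, mulVec_smul, mulVec_mulVec, mul_nonsing_inv _ hdet, one_mulVec]
  rw [sub_mulVec, smul_mulVec, one_mulVec, ← mulVec_mulVec, ← mulVec_mulVec] at this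
  rw [smul_sub, ← this]
  abel

/-- Stationarity in `w'` of `v(x_{t+1}) - λ‖w' - w‖²`, which is what dictates the formula for the
displacement. -/
lemma first_order (hlam : 0 < lam) (hu : IsUnit (1 + P * S.Phi lam).det)
    (hD : (lam • (1 : Matrix (Fin k) (Fin k) ℝ) - S.Xiᵀ * P * S.Xi).PosDef)
    (x : Fin n → ℝ) (w : Fin k → ℝ) :
    S.Xiᵀ *ᵥ (P *ᵥ S.saddleNext lam P r wb x w + r) =
      lam • (S.saddleDisturbance lam P r wb x w - w) := by
  rw [gradient_saddleNext hu, mulVec_add, spread_eq hD, saddleDisturbance]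
  simp only [smul_sub, smul_add, smul_smul, mul_one_div_cancel hlam.ne', one_smul]
  abel

/-- The saddle point disturbance is a best response to the saddle point input. -/
lemma le_saddleTerm (hlam : 0 < lam) (hP : Pᵀ = P) (hu : IsUnit (1 + P * S.Phi lam).det)
    (hD : (lam • (1 : Matrix (Fin k) (Fin k) ℝ) - S.Xiᵀ * P * S.Xi).PosDef)
    (x : Fin n → ℝ) (w w' : Fin k → ℝ) :
    quad P r s (S.A *ᵥ x + S.B *ᵥ S.saddleInput lam P r wb x + S.Xi *ᵥ w') -
      lam * ((w' - w) ⬝ᵥ (w' - w)) ≤ S.saddleTerm lam P r s wb x w := by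
  set ws := S.saddleDisturbance lam P r wb x w with hws
  obtain ⟨d, rfl⟩ : ∃ d, w' = ws + d := ⟨w' - ws, by simp⟩
  have e1 : S.A *ᵥ x + S.B *ᵥ S.saddleInput lam P r wb x + S.Xi *ᵥ (ws + d) =
      S.saddleNext lam P r wb x w + S.Xi *ᵥ d := by
    rw [saddleNext, mulVec_add, ← hws]; abel
  have e2 : ws + d - w = (ws - w) + d := by abel
  -- The first-order terms in `d` cancel by `first_order`; what remains is `-dᵀ(λI - ΞᵀPΞ)d`.
  have h := PosSemidef.dot_nonneg hD.posSemidef d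
  rw [sub_mulVec, smul_mulVec, one_mulVec, ← mulVec_mulVec, ← mulVec_mulVec, dotProduct_sub,
    ← dotProduct_mulVec_transpose, dotProduct_smul, smul_eq_mul] at h
  have h2 : (S.Xi *ᵥ d) ⬝ᵥ (P *ᵥ S.saddleNext lam P r wb x w + r) = lam * (d ⬝ᵥ (ws - w)) := by
    rw [dotProduct_comm, dotProduct_mulVec_transpose, first_order hlam hu hD, dotProduct_smul,
      smul_eq_mul]
  rw [e1, e2, quad_add hP, dot_self_add, h2, saddleTerm, ← hws]
  rw [dotProduct_comm (P *ᵥ S.Xi *ᵥ d)] at h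
  linarith

/-- Moving away from the saddle point input does not decrease the cost, up to a term that is
linear in the deviation of the disturbance. -/
lemma saddleTerm_le (hR : S.R.PosDef) (hP : P.PosSemidef)
    (hu : IsUnit (1 + P * S.Phi lam).det) (x : Fin n → ℝ) (u : Fin m → ℝ) (w : Fin k → ℝ) :
    S.saddleInput lam P r wb x ⬝ᵥ S.R *ᵥ S.saddleInput lam P r wb x +
        S.saddleTerm lam P r s wb x w +
        2 * ((u - S.saddleInput lam P r wb x) ⬝ᵥ S.Bᵀ *ᵥ P *ᵥ S.Xi *ᵥ S.spread lam P wb w) ≤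
      u ⬝ᵥ S.R *ᵥ u + (quad P r s (S.A *ᵥ x + S.B *ᵥ u +
        S.Xi *ᵥ S.saddleDisturbance lam P r wb x w) -
      lam * ((S.saddleDisturbance lam P r wb x w - w) ⬝ᵥ
        (S.saddleDisturbance lam P r wb x w - w))) := by
  set us := S.saddleInput lam P r wb x with hus
  obtain ⟨d, rfl⟩ : ∃ d, u = us + d := ⟨u - us, by simp⟩
  have e1 : S.A *ᵥ x + S.B *ᵥ (us + d) + S.Xi *ᵥ S.saddleDisturbance lam P r wb x w =
      S.saddleNext lam P r wb x w + S.B *ᵥ d := by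
    rw [saddleNext, mulVec_add, ← hus]; abel
  have h1 := PosSemidef.dot_nonneg hP (S.B *ᵥ d)
  have h2 := PosSemidef.dot_nonneg hR.posSemidef d
  -- The costate part cancels against `R u* = -Bᵀg`. The spread part need not vanish for a single
  -- sample, only on average.
  have h3 : (S.B *ᵥ d) ⬝ᵥ (P *ᵥ S.saddleNext lam P r wb x w + r) =
      d ⬝ᵥ S.Bᵀ *ᵥ S.costate lam P r wb x +
      d ⬝ᵥ S.Bᵀ *ᵥ P *ᵥ S.Xi *ᵥ S.spread lam P wb w := by
    rw [dotProduct_comm, dotProduct_mulVec_transpose, gradient_saddleNext hu, mulVec_add,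
      dotProduct_add]
  rw [e1, quad_add (PosSemidef.transpose_eq hP), h3, dot_mulVec_add (PosSemidef.transpose_eq
    hR.posSemidef), R_mulVec_saddleInput hR, saddleTerm, dotProduct_neg, dotProduct_neg,
    add_sub_cancel_left]
  linarith

/-- The additive constant in the value function, one stage earlier. -/
def riccatiConst (S : Problem n m k N) (lam : ℝ) (P : Matrix (Fin n) (Fin n) ℝ) (r : Fin n → ℝ)
    (s : ℝ) (wb : Fin k → ℝ) (ws : Fin N → Fin k → ℝ) : ℝ :=
  (S.Xi *ᵥ wb) ⬝ᵥ ((1 + P * S.Phi lam)⁻¹ * P) *ᵥ (S.Xi *ᵥ wb) +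
    2 * ((S.Xi *ᵥ wb) ⬝ᵥ (1 + P * S.Phi lam)⁻¹ *ᵥ r) -
    r ⬝ᵥ S.Phi lam *ᵥ (1 + P * S.Phi lam)⁻¹ *ᵥ r + s +
    (N : ℝ)⁻¹ * ∑ i, ((S.spread lam P wb (ws i)) ⬝ᵥ S.Xiᵀ *ᵥ P *ᵥ S.Xi *ᵥ S.spread lam P wb (ws i) -
      lam * ((S.spread lam P wb (ws i) - (ws i - wb)) ⬝ᵥ (S.spread lam P wb (ws i) - (ws i - wb))))

/-- Separates mean from spread. The products of costate and spread cancel, leaving only `2(Ξᵀg)ᵀ(w -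
w̄)`, which averages to zero over the samples. -/
lemma saddleTerm_eq (hlam : 0 < lam) (hP : Pᵀ = P) (hu : IsUnit (1 + P * S.Phi lam).det)
    (x : Fin n → ℝ) (w : Fin k → ℝ) :
    S.saddleTerm lam P r s wb x w =
      quad P r s (S.A *ᵥ x + S.Xi *ᵥ wb - S.Phi lam *ᵥ S.costate lam P r wb x) -
      1 / lam * ((S.Xiᵀ *ᵥ S.costate lam P r wb x) ⬝ᵥ (S.Xiᵀ *ᵥ S.costate lam P r wb x)) +
      2 * ((S.Xiᵀ *ᵥ S.costate lam P r wb x) ⬝ᵥ (w - wb)) +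
      (S.spread lam P wb w ⬝ᵥ S.Xiᵀ *ᵥ P *ᵥ S.Xi *ᵥ S.spread lam P wb w -
      lam * ((S.spread lam P wb w - (w - wb)) ⬝ᵥ (S.spread lam P wb w - (w - wb)))) := by
  have e : S.saddleDisturbance lam P r wb x w - w =
      (1 / lam) • S.Xiᵀ *ᵥ S.costate lam P r wb x + (S.spread lam P wb w - (w - wb)) := by
    rw [saddleDisturbance]; abel
  have h1 : (S.Xi *ᵥ S.spread lam P wb w) ⬝ᵥ S.costate lam P r wb x =
      S.spread lam P wb w ⬝ᵥ S.Xiᵀ *ᵥ S.costate lam P r wb x := by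
    rw [dotProduct_comm, dotProduct_mulVec_transpose]
  have h2 : (S.Xi *ᵥ S.spread lam P wb w) ⬝ᵥ P *ᵥ S.Xi *ᵥ S.spread lam P wb w =
      S.spread lam P wb w ⬝ᵥ S.Xiᵀ *ᵥ P *ᵥ S.Xi *ᵥ S.spread lam P wb w := by
    rw [dotProduct_comm, dotProduct_mulVec_transpose]
  rw [saddleTerm, e, saddleNext_eq, quad_add hP, costate_eq hu, dot_self_add, h1, h2]
  simp only [dotProduct_smul, smul_dotProduct, smul_eq_mul, sub_dotProduct]
  rw [dotProduct_comm (S.Xiᵀ *ᵥ S.costate lam P r wb x) (w - wb)]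
  simp only [dotProduct_sub, sub_dotProduct]
  field_simp
  ring

lemma sum_sub_mean {ws : Fin N → Fin k → ℝ} (hN : 0 < N) (hwb : wb = (N : ℝ)⁻¹ • ∑ i, ws i) :
    ∑ i, (ws i - wb) = 0 := by
  have : (N : ℝ) ≠ 0 := by positivity
  rw [Finset.sum_sub_distrib, Finset.sum_const, Finset.card_univ, Fintype.card_fin, hwb,
    ← Nat.cast_smul_eq_nsmul ℝ, smul_smul, mul_inv_cancel₀ this, one_smul, sub_self]

/-- The saddle value of a stage is the next quadratic function of the Riccati recursion. -/
lemma saddle_value (hR : S.R.PosDef) (hlam : 0 < lam) (hP : Pᵀ = P)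
    (hu : IsUnit (1 + P * S.Phi lam).det) (hN : 0 < N) {ws : Fin N → Fin k → ℝ}
    (hwb : wb = (N : ℝ)⁻¹ • ∑ i, ws i) (x : Fin n → ℝ) :
    S.stageCost x (S.saddleInput lam P r wb x) +
        (N : ℝ)⁻¹ * ∑ i, S.saddleTerm lam P r s wb x (ws i) =
      quad (S.Q + S.Aᵀ * (1 + P * S.Phi lam)⁻¹ * P * S.A)
        (S.Aᵀ *ᵥ ((1 + P * S.Phi lam)⁻¹ *ᵥ ((P * S.Xi) *ᵥ wb + r)))
        (S.riccatiConst lam P r s wb ws) x := by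
  have hN' : (N : ℝ) ≠ 0 := by positivity
  have hsum : ∑ i, (S.Xiᵀ *ᵥ S.costate lam P r wb x) ⬝ᵥ (ws i - wb) = 0 := by
    rw [← dotProduct_sum, sum_sub_mean hN hwb, dotProduct_zero]
  set g := S.costate lam P r wb x with hg
  set b := S.A *ᵥ x + S.Xi *ᵥ wb with hb
  -- The term `(1/λ)‖Ξᵀg‖²` will cancel the mean transport cost in `havg`.
  have hus : S.saddleInput lam P r wb x ⬝ᵥ S.R *ᵥ S.saddleInput lam P r wb x =
      g ⬝ᵥ S.Phi lam *ᵥ g + 1 / lam * ((S.Xiᵀ *ᵥ g) ⬝ᵥ (S.Xiᵀ *ᵥ g)) := by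
    rw [S.dot_Phi hR lam g g, saddleInput]; simp [mulVec_neg, ← hg]
  have havg : (N : ℝ)⁻¹ * ∑ i, S.saddleTerm lam P r s wb x (ws i) =
      quad P r s (b - S.Phi lam *ᵥ g) - 1 / lam * ((S.Xiᵀ *ᵥ g) ⬝ᵥ (S.Xiᵀ *ᵥ g)) +
      (N : ℝ)⁻¹ * ∑ i, ((S.spread lam P wb (ws i)) ⬝ᵥ
        S.Xiᵀ *ᵥ P *ᵥ S.Xi *ᵥ S.spread lam P wb (ws i) -
      lam * ((S.spread lam P wb (ws i) - (ws i - wb)) ⬝ᵥ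
        (S.spread lam P wb (ws i) - (ws i - wb)))) := by
    simp only [saddleTerm_eq hlam hP hu, ← hg, ← hb]
    rw [Finset.sum_add_distrib, Finset.sum_add_distrib, ← Finset.mul_sum, hsum, Finset.sum_const,
      Finset.card_univ, Fintype.card_fin, nsmul_eq_mul]
    field_simp
    ring
  have hW := S.inv_mul_transpose hR lam hP hu
  have hM : (1 + P * S.Phi lam)⁻¹ *ᵥ r +
      ((1 + P * S.Phi lam)⁻¹ * P) *ᵥ S.Phi lam *ᵥ r = r := by
    rw [mulVec_mulVec, ← add_mulVec, Matrix.mul_assoc]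
    nth_rw 1 [← Matrix.mul_one (1 + P * S.Phi lam)⁻¹]
    rw [← mul_add, nonsing_inv_mul _ hu, one_mulVec]
  have hgW : g = ((1 + P * S.Phi lam)⁻¹ * P) *ᵥ b + (1 + P * S.Phi lam)⁻¹ *ᵥ r := by
    rw [hg, costate, mulVec_add, mulVec_mulVec]
  have hPz := costate_eq (r := r) (wb := wb) hu x
  rw [← hg, ← hb] at hPz
  have hq : quad P r s (b - S.Phi lam *ᵥ g) = b ⬝ᵥ g - g ⬝ᵥ S.Phi lam *ᵥ g + r ⬝ᵥ b -
      r ⬝ᵥ S.Phi lam *ᵥ g + s := by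
    rw [quad, eq_sub_of_add_eq hPz, dotProduct_sub, dotProduct_comm _ r, dotProduct_sub,
      sub_dotProduct, dotProduct_comm _ g, dotProduct_comm _ g]
    ring
  rw [havg, stageCost, hus, hq, riccatiConst]
  set M := (1 + P * S.Phi lam)⁻¹ with hMdef
  set W := M * P with hWdef
  -- Obtained by pairing `hM` with `b`, using the symmetry of `W` and `Φ`.
  have hcross : r ⬝ᵥ S.Phi lam *ᵥ W *ᵥ b = r ⬝ᵥ b - b ⬝ᵥ M *ᵥ r := by
    have h1 : b ⬝ᵥ r = b ⬝ᵥ M *ᵥ r + b ⬝ᵥ W *ᵥ S.Phi lam *ᵥ r := by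
      rw [← dotProduct_add, hM]
    have h2 : b ⬝ᵥ W *ᵥ S.Phi lam *ᵥ r = r ⬝ᵥ S.Phi lam *ᵥ W *ᵥ b := by
      rw [dotProduct_mulVec_transpose, hW, dotProduct_comm, dotProduct_mulVec_transpose,
        S.Phi_transpose hR, dotProduct_comm, dotProduct_comm]
    rw [dotProduct_comm r b]; linarith
  have hx : x ⬝ᵥ (S.Aᵀ * M * P * S.A) *ᵥ x = (S.A *ᵥ x) ⬝ᵥ W *ᵥ (S.A *ᵥ x) := by
    rw [Matrix.mul_assoc S.Aᵀ, ← hWdef, ← mulVec_mulVec, ← mulVec_mulVec,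
      ← dotProduct_mulVec_transpose, dotProduct_comm]
  have hr : (S.Aᵀ *ᵥ (M *ᵥ ((P * S.Xi) *ᵥ wb + r))) ⬝ᵥ x =
      (S.A *ᵥ x) ⬝ᵥ W *ᵥ S.Xi *ᵥ wb + (S.A *ᵥ x) ⬝ᵥ M *ᵥ r := by
    rw [dotProduct_comm, ← dotProduct_mulVec_transpose, dotProduct_comm, mulVec_add,
      dotProduct_add, ← mulVec_mulVec, mulVec_mulVec]
  have hbb : b ⬝ᵥ W *ᵥ b = (S.A *ᵥ x) ⬝ᵥ W *ᵥ (S.A *ᵥ x) +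
      2 * ((S.A *ᵥ x) ⬝ᵥ W *ᵥ S.Xi *ᵥ wb) + (S.Xi *ᵥ wb) ⬝ᵥ W *ᵥ (S.Xi *ᵥ wb) := by
    rw [hb, dot_mulVec_add hW, dotProduct_mulVec_transpose W (S.Xi *ᵥ wb), hW]
  have hbg : b ⬝ᵥ g = b ⬝ᵥ W *ᵥ b + b ⬝ᵥ M *ᵥ r := by rw [hgW, dotProduct_add]
  have hrg : r ⬝ᵥ S.Phi lam *ᵥ g = r ⬝ᵥ b - b ⬝ᵥ M *ᵥ r + r ⬝ᵥ S.Phi lam *ᵥ M *ᵥ r := by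
    rw [hgW, mulVec_add, dotProduct_add, hcross]
  have hbM : b ⬝ᵥ M *ᵥ r = (S.A *ᵥ x) ⬝ᵥ M *ᵥ r + (S.Xi *ᵥ wb) ⬝ᵥ M *ᵥ r := by
    rw [hb, add_dotProduct]
  rw [hbg, hrg, quad, add_mulVec, dotProduct_add x, hx, hr, hbb, hbM]
  ring
end
end Problem
end WassersteinControl
end

/-! ### Extended expectations and compensated sums -/

noncomputable section

namespace WassersteinControl

section ExtExpectation
variable {Ω : Type*} [MeasurableSpace Ω] {P : Measure Ω}

/-- Measurability is not required, so the lemma applies to the Wasserstein penalty directly; the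
convention `∞ - ∞ = -∞` is compatible with monotone subtraction in `EReal`. -/
lemma extExpectation_mono {f g : Ω → EReal} (h : ∀ᵐ ω ∂P, f ω ≤ g ω) :
    extExpectation P f ≤ extExpectation P g := by
  refine EReal.sub_le_sub ?_ ?_
  · rw [EReal.coe_ennreal_le_coe_ennreal_iff]
    refine lintegral_mono_ae ?_
    filter_upwards [h] with ω hω using EReal.toENNReal_le_toENNReal hω
  · rw [EReal.coe_ennreal_le_coe_ennreal_iff]
    refine lintegral_mono_ae ?_
    filter_upwards [h] with ω hω using EReal.toENNReal_le_toENNReal (EReal.neg_le_neg_iff.2 hω)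

lemma extExpectation_coe (f : Ω → ℝ) :
    extExpectation P (fun ω => (f ω : EReal)) =
      ((∫⁻ ω, ENNReal.ofReal (f ω) ∂P : ℝ≥0∞) : EReal) -
        ((∫⁻ ω, ENNReal.ofReal (-f ω) ∂P : ℝ≥0∞) : EReal) := by
  unfold extExpectation
  congr 4 with ω

lemma extExpectation_of_integrable {f : Ω → ℝ} (hf : Integrable f P) :
    extExpectation P (fun ω => (f ω : EReal)) = ((∫ ω, f ω ∂P : ℝ) : EReal) := by
  have h1 : ∫⁻ ω, ENNReal.ofReal (f ω) ∂P ≠ ⊤ := hf.lintegral_lt_top.ne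
  have h2 : ∫⁻ ω, ENNReal.ofReal (-f ω) ∂P ≠ ⊤ := hf.neg.lintegral_lt_top.ne
  rw [extExpectation_coe, integral_eq_lintegral_pos_part_sub_lintegral_neg_part hf,
    EReal.coe_sub, EReal.coe_ennreal_toReal h1, EReal.coe_ennreal_toReal h2]

lemma extExpectation_eq_bot {f : Ω → EReal} (h : ∫⁻ ω, (-f ω).toENNReal ∂P = ⊤) :
    extExpectation P f = ⊥ := by
  rw [extExpectation, h, EReal.coe_ennreal_top, EReal.sub_top]

/-- Nonnegativity of `f` bounds the negative part of `f - c`. If `f` is not integrable, the right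
side is therefore `∞`, not the undefined case. -/
lemma extExpectation_le_sub_add [IsProbabilityMeasure P] {f : Ω → ℝ} (hf : Measurable f)
    (h0 : ∀ ω, 0 ≤ f ω) (c : ℝ) :
    extExpectation P (fun ω => (f ω : EReal)) ≤
      extExpectation P (fun ω => ((f ω - c : ℝ) : EReal)) + (c : EReal) := by
  by_cases hint : Integrable f P
  · have hint' : Integrable (fun ω => f ω - c) P := hint.sub (integrable_const c)
    rw [extExpectation_of_integrable hint, extExpectation_of_integrable hint',
      integral_sub hint (integrable_const c), ← EReal.coe_add]
    simp
  · have h1 : ∫⁻ ω, ENNReal.ofReal (f ω) ∂P = ⊤ := by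
      by_contra h
      exact hint ((lintegral_ofReal_ne_top_iff_integrable hf.aestronglyMeasurable
        (Filter.Eventually.of_forall h0)).1 h)
    have h2 : ∫⁻ ω, ENNReal.ofReal (f ω - c) ∂P = ⊤ := by
      by_contra h
      have : ∫⁻ ω, ENNReal.ofReal (f ω) ∂P ≤
          ∫⁻ ω, (ENNReal.ofReal (f ω - c) + ENNReal.ofReal c) ∂P := by
        refine lintegral_mono fun ω => ?_
        refine le_trans (ENNReal.ofReal_le_ofReal (by linarith)) (ENNReal.ofReal_add_le
          (p := f ω - c) (q := c))
      rw [h1, lintegral_add_right _ measurable_const, lintegral_const, measure_univ, mul_one]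
        at this
      exact ENNReal.add_ne_top.2 ⟨h, ENNReal.ofReal_ne_top⟩ (top_le_iff.1 this)
    have h3 : ∫⁻ ω, ENNReal.ofReal (-(f ω - c)) ∂P ≠ ⊤ := by
      refine ne_top_of_le_ne_top (b := ENNReal.ofReal c) ENNReal.ofReal_ne_top ?_
      calc _ ≤ ∫⁻ _, ENNReal.ofReal c ∂P :=
            lintegral_mono fun ω => ENNReal.ofReal_le_ofReal (by linarith [h0 ω])
        _ = _ := by simp
    rw [extExpectation_coe (fun ω => f ω - c), h2, EReal.coe_ennreal_top,
      ← EReal.coe_ennreal_toReal h3, EReal.top_sub_coe, EReal.top_add_coe]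
    exact le_top

end ExtExpectation

/-- Splitting into positive and negative parts of the mean of a shifted random variable. -/
lemma lintegral_shift {X : Type*} [MeasurableSpace X] {κ : Measure X} [IsProbabilityMeasure κ]
    {v : X → ℝ} (hv : Integrable v κ) (a : ℝ) :
    ∫⁻ y, ENNReal.ofReal (a + (v y - ∫ z, v z ∂κ)) ∂κ + ENNReal.ofReal (-a) =
        ENNReal.ofReal a + ∫⁻ y, ENNReal.ofReal (-(a + (v y - ∫ z, v z ∂κ))) ∂κ ∧
      ENNReal.ofReal (-a) ≤ ∫⁻ y, ENNReal.ofReal (-(a + (v y - ∫ z, v z ∂κ))) ∂κ := by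
  have hint : Integrable (fun y => a + (v y - ∫ z, v z ∂κ)) κ :=
    (integrable_const a).add (hv.sub (integrable_const _))
  have hint' : Integrable (fun y => v y - ∫ z, v z ∂κ) κ := hv.sub (integrable_const _)
  -- The increment is centred, so the mean is `a`; the second claim is Jensen's inequality for the
  -- negative part.
  have hmean : ∫ y, (a + (v y - ∫ z, v z ∂κ)) ∂κ = a := by
    rw [integral_add (integrable_const a) hint',
      integral_sub hv (integrable_const _)]
    simp
  rw [integral_eq_lintegral_pos_part_sub_lintegral_neg_part hint] at hmean
  have h1 := hint.lintegral_lt_top.ne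
  have h2 : ∫⁻ y, ENNReal.ofReal (-(a + (v y - ∫ z, v z ∂κ))) ∂κ ≠ ⊤ :=
    hint.neg.lintegral_lt_top.ne
  set p := ∫⁻ y, ENNReal.ofReal (a + (v y - ∫ z, v z ∂κ)) ∂κ
  set q := ∫⁻ y, ENNReal.ofReal (-(a + (v y - ∫ z, v z ∂κ))) ∂κ
  have hp : 0 ≤ p.toReal := ENNReal.toReal_nonneg
  have hq : 0 ≤ q.toReal := ENNReal.toReal_nonneg
  rw [← ENNReal.ofReal_toReal h1, ← ENNReal.ofReal_toReal h2]
  constructor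
  · rcases le_total 0 a with ha | ha
    · rw [ENNReal.ofReal_of_nonpos (by linarith : -a ≤ 0), add_zero, ← ENNReal.ofReal_add ha hq]
      congr 1; linarith
    · rw [ENNReal.ofReal_of_nonpos ha, zero_add, ← ENNReal.ofReal_add hp (by linarith)]
      congr 1; linarith
  · exact ENNReal.ofReal_le_ofReal (by linarith)

namespace Problem

variable {n m k N : ℕ} (S : Problem n m k N)

instance (π : Policy n m) (γ : Opponent n k) (x : Fin n → ℝ) :
    IsProbabilityMeasure (S.law π γ x) := by
  unfold law; infer_instance

/-- The joint law of the history up to `t` and `x_{t+1}` is the composition product of the history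
law with the transition kernel. -/
lemma lintegral_law_succ (π : Policy n m) (γ : Opponent n k) (x : Fin n → ℝ) (t : ℕ)
    {f : (Finset.Iic t → Fin n → ℝ) × (Fin n → ℝ) → ℝ≥0∞} (hf : Measurable f) :
    ∫⁻ ξ, f (Preorder.frestrictLe t ξ, ξ (t + 1)) ∂S.law π γ x =
      ∫⁻ ξ, ∫⁻ y, f (Preorder.frestrictLe t ξ, y) ∂S.step π γ t (ξ t) ∂S.law π γ x := by
  have h1 : Measurable fun ξ : ℕ → Fin n → ℝ =>
      ((Preorder.frestrictLe t ξ : Finset.Iic t → Fin n → ℝ), ξ (t + 1)) := by fun_prop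
  have h2 := Kernel.partialTraj_compProd_eq_map_traj (X := fun _ => Fin n → ℝ)
    (κ := S.historyStep π γ) (Nat.zero_le t) (x₀ := fun _ => x)
  rw [← lintegral_map hf h1, law, ← h2, Measure.lintegral_compProd hf,
    ← Kernel.traj_map_frestrictLe_apply, lintegral_map (hf.lintegral_kernel_prod_right')
      (by fun_prop)]
  rfl

/-- A trajectory with the given initial piece. -/
def extend {n : ℕ} (t : ℕ) (h : Finset.Iic t → Fin n → ℝ) : ℕ → Fin n → ℝ :=
  fun s => if hs : s ≤ t then h ⟨s, Finset.mem_Iic.2 hs⟩ else 0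

lemma measurable_extend (t : ℕ) : Measurable (extend (n := n) t) := by
  refine measurable_pi_lambda _ fun s => ?_
  unfold extend
  split_ifs
  · exact measurable_pi_apply _
  · exact measurable_const

/-- Rephrases conditioning on the history for functions of whole trajectories: one that depends only
on times up to `t` is unchanged when the later states are replaced by zero. -/
lemma lintegral_law_adapted (π : Policy n m) (γ : Opponent n k) (x : Fin n → ℝ) (t : ℕ)
    {f : (ℕ → Fin n → ℝ) × (Fin n → ℝ) → ℝ≥0∞} (hf : Measurable f)
    (had : ∀ ξ ξ' y, (∀ s ≤ t, ξ s = ξ' s) → f (ξ, y) = f (ξ', y)) :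
    ∫⁻ ξ, f (ξ, ξ (t + 1)) ∂S.law π γ x =
      ∫⁻ ξ, ∫⁻ y, f (ξ, y) ∂S.step π γ t (ξ t) ∂S.law π γ x := by
  have h := S.lintegral_law_succ π γ x t (f := fun p => f (extend t p.1, p.2))
    (hf.comp (((measurable_extend t).comp measurable_fst).prodMk measurable_snd))
  have e : ∀ ξ y, f (extend t (Preorder.frestrictLe t ξ), y) = f (ξ, y) := fun ξ y =>
    had _ _ _ fun s hs => by simp [extend, hs]
  simpa only [e] using h

lemma law_zero (π : Policy n m) (γ : Opponent n k) (x : Fin n → ℝ) :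
    ∀ᵐ ξ ∂S.law π γ x, ξ 0 = x := by
  have h : (S.law π γ x).map (Preorder.frestrictLe 0) = Measure.dirac fun _ => x := by
    rw [law, Kernel.traj_map_frestrictLe_apply, Kernel.partialTraj_self, Kernel.id_apply]
  have h' : ∀ᵐ y ∂(S.law π γ x).map (Preorder.frestrictLe 0), y = fun _ => x := by
    rw [h]; exact (ae_dirac_iff (measurableSet_eq_fun measurable_id measurable_const)).2 rfl
  have := ae_of_ae_map (Preorder.measurable_frestrictLe 0).aemeasurable h'
  filter_upwards [this] with ξ hξ
  exact congrFun hξ ⟨0, by simp⟩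

/-- The sum of `v 0 x_0` and the compensated increments of `v t x_t`. -/
def compensated (π : Policy n m) (γ : Opponent n k) (v : ℕ → (Fin n → ℝ) → ℝ) (t : ℕ)
    (ξ : ℕ → Fin n → ℝ) : ℝ :=
  v 0 (ξ 0) + ∑ s ∈ Finset.range t, (v (s + 1) (ξ (s + 1)) - ∫ y, v (s + 1) y ∂S.step π γ s (ξ s))

lemma measurable_integral_step (π : Policy n m) (γ : Opponent n k) {v : (Fin n → ℝ) → ℝ}
    (hv : Measurable v) (t : ℕ) : Measurable fun x => ∫ y, v y ∂S.step π γ t x :=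
  (hv.stronglyMeasurable.integral_kernel (κ := S.step π γ t)).measurable

lemma measurable_compensated (π : Policy n m) (γ : Opponent n k) {v : ℕ → (Fin n → ℝ) → ℝ}
    (hv : ∀ t, Measurable (v t)) (t : ℕ) : Measurable (S.compensated π γ v t) := by
  unfold compensated
  refine ((hv 0).comp (measurable_pi_apply 0)).add (Finset.measurable_sum _ fun s _ => ?_)
  exact ((hv _).comp (measurable_pi_apply _)).sub
    ((S.measurable_integral_step π γ (hv _) s).comp (measurable_pi_apply s))

/-- A generalized martingale whose negative part is integrable has constant expectation. -/
lemma integral_compensated (π : Policy n m) (γ : Opponent n k) {v : ℕ → (Fin n → ℝ) → ℝ}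
    (hv : ∀ t, Measurable (v t)) (x : Fin n → ℝ) (T : ℕ)
    (hint : ∀ t < T, ∀ᵐ ξ ∂S.law π γ x, Integrable (v (t + 1)) (S.step π γ t (ξ t)))
    (hneg : ∫⁻ ξ, ENNReal.ofReal (-S.compensated π γ v T ξ) ∂S.law π γ x ≠ ⊤) :
    Integrable (S.compensated π γ v T) (S.law π γ x) ∧
      ∫ ξ, S.compensated π γ v T ξ ∂S.law π γ x = v 0 x := by
  induction T with
  | zero =>
    have h : S.compensated π γ v 0 =ᵐ[S.law π γ x] fun _ => v 0 x := by
      filter_upwards [S.law_zero π γ x] with ξ hξ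
      simp [compensated, hξ]
    exact ⟨(integrable_const _).congr h.symm, by rw [integral_congr_ae h]; simp⟩
  | succ T ih =>
    have hm := S.measurable_compensated π γ hv
    have hsucc : ∀ ξ, S.compensated π γ v (T + 1) ξ = S.compensated π γ v T ξ +
        (v (T + 1) (ξ (T + 1)) - ∫ y, v (T + 1) y ∂S.step π γ T (ξ T)) := fun ξ => by
      simp only [compensated, Finset.sum_range_succ, add_assoc]
    have hmf : Measurable fun p : (ℕ → Fin n → ℝ) × (Fin n → ℝ) => S.compensated π γ v T p.1 +
        (v (T + 1) p.2 - ∫ y, v (T + 1) y ∂S.step π γ T (p.1 T)) :=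
      ((hm T).comp measurable_fst).add (((hv _).comp measurable_snd).sub
        ((S.measurable_integral_step π γ (hv _) T).comp
          ((measurable_pi_apply T).comp measurable_fst)))
    have had : ∀ (ξ ξ' : ℕ → Fin n → ℝ), (∀ s ≤ T, ξ s = ξ' s) →
        S.compensated π γ v T ξ = S.compensated π γ v T ξ' := fun ξ ξ' h => by
      unfold compensated
      rw [h 0 (Nat.zero_le _)]
      congr 1
      refine Finset.sum_congr rfl fun s hs => ?_
      have := Finset.mem_range.1 hs
      rw [h s (by omega), h (s + 1) (by omega)]
    have hpos' := S.lintegral_law_adapted π γ x T (f := fun p => ENNReal.ofReal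
      (S.compensated π γ v T p.1 + (v (T + 1) p.2 - ∫ y, v (T + 1) y ∂S.step π γ T (p.1 T))))
      hmf.ennreal_ofReal (fun ξ ξ' y h => by
        simp only [had ξ ξ' h, h T le_rfl])
    have hneg' := S.lintegral_law_adapted π γ x T (f := fun p => ENNReal.ofReal
      (-(S.compensated π γ v T p.1 + (v (T + 1) p.2 - ∫ y, v (T + 1) y ∂S.step π γ T (p.1 T)))))
      hmf.neg.ennreal_ofReal (fun ξ ξ' y h => by
        simp only [had ξ ξ' h, h T le_rfl])
    simp only [← hsucc] at hpos' hneg'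
    have hmn : Measurable fun ξ => ENNReal.ofReal (-S.compensated π γ v T ξ) :=
      (hm T).neg.ennreal_ofReal
    have hstep := hint T (Nat.lt_succ_self T)
    -- By Jensen the negative parts grow with time, so finiteness at the last stage passes to the
    -- earlier ones.
    have hle : ∫⁻ ξ, ENNReal.ofReal (-S.compensated π γ v T ξ) ∂S.law π γ x ≤
        ∫⁻ ξ, ENNReal.ofReal (-S.compensated π γ v (T + 1) ξ) ∂S.law π γ x := by
      rw [hneg']
      refine lintegral_mono_ae ?_
      filter_upwards [hstep] with ξ hξ using (lintegral_shift hξ _).2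
    -- Equality of means in additive form, since the positive part at `T + 1` may still be infinite
    -- here.
    have heq : ∫⁻ ξ, ENNReal.ofReal (S.compensated π γ v (T + 1) ξ) ∂S.law π γ x +
        ∫⁻ ξ, ENNReal.ofReal (-S.compensated π γ v T ξ) ∂S.law π γ x =
        ∫⁻ ξ, ENNReal.ofReal (S.compensated π γ v T ξ) ∂S.law π γ x +
        ∫⁻ ξ, ENNReal.ofReal (-S.compensated π γ v (T + 1) ξ) ∂S.law π γ x := by
      rw [hpos', hneg', ← lintegral_add_right' _ hmn.aemeasurable,
        ← lintegral_add_left (hm T).ennreal_ofReal]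
      refine lintegral_congr_ae ?_
      filter_upwards [hstep] with ξ hξ using (lintegral_shift hξ _).1
    have hnegT := ne_top_of_le_ne_top hneg hle
    obtain ⟨ih1, ih2⟩ := ih (fun t ht => hint t (by omega)) hnegT
    have hposT : ∫⁻ ξ, ENNReal.ofReal (S.compensated π γ v T ξ) ∂S.law π γ x ≠ ⊤ :=
      ih1.lintegral_lt_top.ne
    -- The right side of `heq` is finite, hence so is the positive part on the left.
    have hpos : ∫⁻ ξ, ENNReal.ofReal (S.compensated π γ v (T + 1) ξ) ∂S.law π γ x ≠ ⊤ := by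
      intro h
      rw [h, top_add] at heq
      exact ENNReal.add_ne_top.2 ⟨hposT, hneg⟩ heq.symm
    have hI : Integrable (S.compensated π γ v (T + 1)) (S.law π γ x) := by
      refine ⟨(hm _).aestronglyMeasurable, ?_⟩
      have : ∀ ξ, ‖S.compensated π γ v (T + 1) ξ‖ₑ ≤
          ENNReal.ofReal (S.compensated π γ v (T + 1) ξ) +
          ENNReal.ofReal (-S.compensated π γ v (T + 1) ξ) := fun ξ => by
        rw [Real.enorm_eq_ofReal_abs]
        rcases abs_choice (S.compensated π γ v (T + 1) ξ) with h | h <;> rw [h] <;> simp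
      refine lt_of_le_of_lt (lintegral_mono this) ?_
      rw [lintegral_add_left (hm _).ennreal_ofReal]
      exact (ENNReal.add_ne_top.2 ⟨hpos, hneg⟩).lt_top
    refine ⟨hI, ?_⟩
    rw [← ih2, integral_eq_lintegral_pos_part_sub_lintegral_neg_part hI,
      integral_eq_lintegral_pos_part_sub_lintegral_neg_part ih1]
    have := congrArg ENNReal.toReal heq
    rw [ENNReal.toReal_add hpos hnegT, ENNReal.toReal_add hposT hneg] at this
    linarith

end Problem
end WassersteinControl
end

/-! ### Wasserstein bounds, value functions and the opponent's stage bound -/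

noncomputable section

namespace WassersteinControl

lemma wasserstein2_sq_le {k : ℕ} {μ ν : Measure (EuclideanSpace ℝ (Fin k))}
    {η : Measure (EuclideanSpace ℝ (Fin k) × EuclideanSpace ℝ (Fin k))} (h1 : η.fst = μ)
    (h2 : η.snd = ν) : wasserstein2 μ ν ^ 2 ≤ ∫⁻ p, ‖p.1 - p.2‖ₑ ^ 2 ∂η := by
  have h : wasserstein2 μ ν ≤ (∫⁻ p, ‖p.1 - p.2‖ₑ ^ 2 ∂η) ^ (1 / 2 : ℝ) :=
    iInf₂_le η ⟨h1, h2⟩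
  calc _ ≤ ((∫⁻ p, ‖p.1 - p.2‖ₑ ^ 2 ∂η) ^ (1 / 2 : ℝ)) ^ 2 := by gcongr
    _ = _ := by rw [← ENNReal.rpow_natCast, ← ENNReal.rpow_mul]; norm_num

lemma le_wasserstein2_sq {k : ℕ} {μ ν : Measure (EuclideanSpace ℝ (Fin k))} {c : ℝ≥0∞}
    (h : ∀ η : Measure (EuclideanSpace ℝ (Fin k) × EuclideanSpace ℝ (Fin k)),
      η.fst = μ → η.snd = ν → c ≤ ∫⁻ p, ‖p.1 - p.2‖ₑ ^ 2 ∂η) : c ≤ wasserstein2 μ ν ^ 2 := by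
  have h1 : c ^ (1 / 2 : ℝ) ≤ wasserstein2 μ ν :=
    le_iInf₂ fun η hη => ENNReal.rpow_le_rpow (h η hη.1 hη.2) (by norm_num)
  calc c = (c ^ (1 / 2 : ℝ)) ^ 2 := by rw [← ENNReal.rpow_natCast, ← ENNReal.rpow_mul]; norm_num
    _ ≤ _ := by gcongr

lemma norm_sub_sq_eq {k : ℕ} (w w' : EuclideanSpace ℝ (Fin k)) :
    ‖w - w'‖ ^ 2 = (w.ofLp - w'.ofLp) ⬝ᵥ (w.ofLp - w'.ofLp) := by
  rw [EuclideanSpace.real_norm_sq_eq]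
  simp [dotProduct, sq]

lemma continuous_quad {n : ℕ} (P : Matrix (Fin n) (Fin n) ℝ) (r : Fin n → ℝ) (s : ℝ) :
    Continuous (quad P r s) := by
  unfold quad
  fun_prop

lemma integrable_quad {Ω : Type*} [MeasurableSpace Ω] {μ : Measure Ω} [IsFiniteMeasure μ]
    {n : ℕ} (P : Matrix (Fin n) (Fin n) ℝ) (r : Fin n → ℝ) (s : ℝ) {z : Ω → Fin n → ℝ}
    (hz : ∀ i, MemLp (fun ω => z ω i) 2 μ) : Integrable (fun ω => quad P r s (z ω)) μ := by
  unfold quad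
  refine (Integrable.add ?_ (Integrable.const_mul ?_ 2)).add (integrable_const s)
  · simp only [dotProduct, mulVec, Finset.mul_sum]
    refine integrable_finsetSum _ fun i _ => integrable_finsetSum _ fun j _ => ?_
    have := ((hz i).integrable_mul (hz j)).const_mul (P i j)
    refine this.congr (Filter.Eventually.of_forall fun ω => ?_)
    simp only [Pi.mul_apply]; ring
  · simp only [dotProduct]
    exact integrable_finsetSum _ fun i _ => ((hz i).integrable one_le_two).const_mul (r i)

lemma memLp_affine {Ω : Type*} [MeasurableSpace Ω] {μ : Measure Ω} [IsFiniteMeasure μ]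
    {n k : ℕ} (y : Fin n → ℝ) (M : Matrix (Fin n) (Fin k) ℝ) {w : Ω → EuclideanSpace ℝ (Fin k)}
    (hw : MemLp w 2 μ) (i : Fin n) : MemLp (fun ω => (y + M *ᵥ (w ω).ofLp) i) 2 μ := by
  have hwj : ∀ j, MemLp (fun ω => (w ω).ofLp j) 2 μ := fun j =>
    hw.of_le ((EuclideanSpace.proj (𝕜 := ℝ) j).continuous.comp_aestronglyMeasurable hw.1)
      (Filter.Eventually.of_forall fun ω => PiLp.norm_apply_le (w ω) j)
  simp only [Pi.add_apply, mulVec, dotProduct]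
  exact (memLp_const (y i)).add (memLp_finsetSum _ fun j _ => (hwj j).const_mul (M i j))

namespace Problem

variable {n m k N : ℕ} (S : Problem n m k N)

lemma isProbabilityMeasure_empirical (hN : 0 < N) (t : ℕ) :
    IsProbabilityMeasure (S.empirical t) := by
  constructor
  have : (N : ℝ≥0∞) ≠ 0 := by exact_mod_cast hN.ne'
  simp [empirical, ENNReal.inv_mul_cancel this (ENNReal.natCast_ne_top N)]

lemma integrable_empirical {E : Type*} [NormedAddCommGroup E] (hN : 0 < N) (t : ℕ)
    (f : EuclideanSpace ℝ (Fin k) → E) : Integrable f (S.empirical t) := by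
  have : (N : ℝ≥0∞) ≠ 0 := by exact_mod_cast hN.ne'
  refine Integrable.smul_measure ?_ (ENNReal.inv_ne_top.2 this)
  exact integrable_finsetSum_measure.2 fun i _ => integrable_dirac (by simp)

lemma integral_empirical {E : Type*} [NormedAddCommGroup E] [NormedSpace ℝ E] [CompleteSpace E]
    (t : ℕ) (f : EuclideanSpace ℝ (Fin k) → E) :
    ∫ w, f w ∂S.empirical t = (N : ℝ)⁻¹ • ∑ i, f (S.sample t i) := by
  rw [empirical, integral_smul_measure, integral_finsetSum_measure
    fun i _ => integrable_dirac (by simp)]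
  simp

lemma mean_ofLp (t : ℕ) :
    (S.mean t).ofLp = (N : ℝ)⁻¹ • ∑ i, (S.sample t i).ofLp := by
  rw [mean, S.integral_empirical t (fun w => w)]
  simp

/-- The additive constants in the value functions, by the number of remaining stages. -/
def constSeq (lam : ℝ) : ℕ → ℝ
  | 0 => 0
  | j + 1 => S.riccatiConst lam (S.riccati lam j).1 (S.riccati lam j).2 (constSeq lam j)
      (S.mean (S.T - (j + 1))).ofLp (fun i => (S.sample (S.T - (j + 1)) i).ofLp)

/-- The value function at stage `t ≤ T`. -/
def valueFn (lam : ℝ) (t : ℕ) (x : Fin n → ℝ) : ℝ :=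
  quad (S.P lam t) (S.r lam t) (S.constSeq lam (S.T - t)) x

lemma measurable_valueFn (lam : ℝ) (t : ℕ) : Measurable (S.valueFn lam t) :=
  (continuous_quad _ _ _).measurable

lemma valueFn_of_lt (lam : ℝ) {t : ℕ} (ht : t < S.T) (x : Fin n → ℝ) :
    S.valueFn lam t x =
      quad (S.Q + S.Aᵀ * (1 + S.P lam (t + 1) * S.Phi lam)⁻¹ * S.P lam (t + 1) * S.A)
        (S.Aᵀ *ᵥ ((1 + S.P lam (t + 1) * S.Phi lam)⁻¹ *ᵥ
          ((S.P lam (t + 1) * S.Xi) *ᵥ (S.mean t).ofLp + S.r lam (t + 1))))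
        (S.riccatiConst lam (S.P lam (t + 1)) (S.r lam (t + 1)) (S.constSeq lam (S.T - (t + 1)))
          (S.mean t).ofLp (fun i => (S.sample t i).ofLp)) x := by
  -- `riccati` and `constSeq` count remaining stages; `t < T` makes the truncated difference a
  -- successor.
  have h : S.T - t = (S.T - (t + 1)) + 1 := by omega
  have h' : S.T - (S.T - (t + 1) + 1) = t := by omega
  rw [valueFn, P, r, h]
  simp only [riccati, constSeq, h']
  rfl

lemma valueFn_terminal (lam : ℝ) (x : Fin n → ℝ) :
    S.valueFn lam S.T x = x ⬝ᵥ S.Qf *ᵥ x := by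
  simp [valueFn, P, r, quad, riccati, constSeq]

lemma riccatiPolicy_act (lam : ℝ) (t : ℕ) (x : Fin n → ℝ) :
    (S.riccatiPolicy lam).act t x =
      S.saddleInput lam (S.P lam (t + 1)) (S.r lam (t + 1)) (S.mean t).ofLp x := by
  change S.gain lam t *ᵥ x + S.offset lam t = _
  rw [gain, offset, saddleInput, costate]
  simp only [neg_mulVec, ← mulVec_mulVec, mulVec_add, neg_add, add_assoc]

variable {S}

lemma posSemidef_P (hQ : S.Q.PosSemidef) (hQf : S.Qf.PosSemidef) (hR : S.R.PosDef) {lam : ℝ}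
    (hlam : 0 < lam) (hpen : S.PenaltyCondition lam) (t : ℕ) :
    (S.P lam t).PosSemidef := by
  have h : ∀ j, j ≤ S.T → (S.riccati lam j).1.PosSemidef := by
    intro j
    induction j with
    | zero => intro _; exact hQf
    | succ j ih =>
      intro hj
      -- The step from `j` to `j + 1` remaining stages uses the penalty condition at `T - j`, which
      -- lies in `1, …, T` because `j < T`.
      have hD := hpen (S.T - j) (by omega) (by omega)
      rw [P, show S.T - (S.T - j) = j by omega] at hD
      exact S.posSemidef_riccati_step hQ hR hlam (ih (by omega)) hD
  exact h _ (by omega)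

/-- The worst-case displacement of a sample at stage `t`. -/
def stageSaddle (S : Problem n m k N) (lam : ℝ) (t : ℕ) (x : Fin n → ℝ)
    (w : EuclideanSpace ℝ (Fin k)) : EuclideanSpace ℝ (Fin k) :=
  WithLp.toLp 2 (S.saddleDisturbance lam (S.P lam (t + 1)) (S.r lam (t + 1)) (S.mean t).ofLp x
    w.ofLp)

lemma continuous_stageSaddle (lam : ℝ) (t : ℕ) :
    Continuous fun p : (Fin n → ℝ) × EuclideanSpace ℝ (Fin k) =>
      S.stageSaddle lam t p.1 p.2 := by
  unfold stageSaddle saddleDisturbance spread costate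
  fun_prop

/-- The value function is the average of the saddle
terms plus the stage cost. -/
lemma valueFn_eq_saddle (hN : 0 < N) (hQ : S.Q.PosSemidef) (hQf : S.Qf.PosSemidef)
    (hR : S.R.PosDef) {lam : ℝ} (hlam : 0 < lam) (hpen : S.PenaltyCondition lam) {t : ℕ}
    (ht : t < S.T) (x : Fin n → ℝ) :
    S.stageCost x ((S.riccatiPolicy lam).act t x) +
      ∫ w, S.saddleTerm lam (S.P lam (t + 1)) (S.r lam (t + 1)) (S.constSeq lam (S.T - (t + 1)))
        (S.mean t).ofLp x w.ofLp ∂S.empirical t = S.valueFn lam t x := by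
  have hP := posSemidef_P hQ hQf hR hlam hpen (t + 1)
  have hu := S.isUnit_one_add_mul_Phi hR hlam hP (hpen (t + 1) (by omega) (by omega))
  rw [S.integral_empirical, S.valueFn_of_lt lam ht, riccatiPolicy_act, smul_eq_mul]
  exact saddle_value hR hlam (PosSemidef.transpose_eq hP) hu hN (S.mean_ofLp t) x

lemma step_apply (π : Policy n m) (γ : Opponent n k) (t : ℕ) (x : Fin n → ℝ) :
    S.step π γ t x = (γ.dist t x).map (S.next π t x) := by
  have := γ.isMarkov t
  rw [step, Kernel.map_apply _ (S.measurable_next π t), Kernel.prod_apply, Kernel.id_apply,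
    Measure.dirac_prod, Measure.map_map (S.measurable_next π t) measurable_prodMk_left]
  rfl

lemma measurable_next_right (π : Policy n m) (t : ℕ) (x : Fin n → ℝ) :
    Measurable (S.next π t x) :=
  (S.measurable_next π t).comp measurable_prodMk_left

lemma integral_step (π : Policy n m) (γ : Opponent n k) (t : ℕ) (x : Fin n → ℝ)
    {v : (Fin n → ℝ) → ℝ} (hv : Measurable v) :
    ∫ y, v y ∂S.step π γ t x = ∫ w, v (S.next π t x w) ∂γ.dist t x := by
  rw [step_apply, integral_map (measurable_next_right π t x).aemeasurable
    hv.aestronglyMeasurable]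

lemma memLp_of_second_moment {μ : Measure (EuclideanSpace ℝ (Fin k))}
    (h : ∫⁻ w, ‖w‖ₑ ^ 2 ∂μ < ⊤) : MemLp (fun w => w) 2 μ := by
  refine ⟨measurable_id.aestronglyMeasurable, ?_⟩
  rw [eLpNorm_lt_top_iff_lintegral_rpow_enorm_lt_top two_ne_zero ENNReal.ofNat_ne_top]
  simpa using h

lemma second_moment_of_memLp {Ω : Type*} [MeasurableSpace Ω] {μ : Measure Ω}
    {f : Ω → EuclideanSpace ℝ (Fin k)}
    (h : MemLp f 2 μ) : ∫⁻ w, ‖f w‖ₑ ^ 2 ∂μ < ⊤ := by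
  have := (eLpNorm_lt_top_iff_lintegral_rpow_enorm_lt_top two_ne_zero ENNReal.ofNat_ne_top).1 h.2
  simpa using this

lemma integrable_valueFn_next (lam : ℝ) (π : Policy n m) (t t' : ℕ) (x : Fin n → ℝ)
    {μ : Measure (EuclideanSpace ℝ (Fin k))} [IsFiniteMeasure μ]
    (h : ∫⁻ w, ‖w‖ₑ ^ 2 ∂μ < ⊤) : Integrable (fun w => S.valueFn lam t' (S.next π t x w)) μ :=
  integrable_quad _ _ _ (memLp_affine _ _ (memLp_of_second_moment h))

/-- Any coupling with the empirical distribution pays at least the gain of the opponent. -/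
lemma stage_upper_coupling (hN : 0 < N) (hQ : S.Q.PosSemidef) (hQf : S.Qf.PosSemidef)
    (hR : S.R.PosDef) {lam : ℝ} (hlam : 0 < lam) (hpen : S.PenaltyCondition lam) {t : ℕ}
    (ht : t < S.T) (x : Fin n → ℝ) {μ : Measure (EuclideanSpace ℝ (Fin k))}
    [IsProbabilityMeasure μ] (h2 : ∫⁻ w, ‖w‖ₑ ^ 2 ∂μ < ⊤)
    {η : Measure (EuclideanSpace ℝ (Fin k) × EuclideanSpace ℝ (Fin k))} (hη1 : η.fst = μ)
    (hη2 : η.snd = S.empirical t) :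
    ENNReal.ofReal ((S.stageCost x ((S.riccatiPolicy lam).act t x) +
      ∫ w, S.valueFn lam (t + 1) (S.next (S.riccatiPolicy lam) t x w) ∂μ - S.valueFn lam t x) / lam)
      ≤ ∫⁻ p, ‖p.1 - p.2‖ₑ ^ 2 ∂η := by
  by_cases hC : ∫⁻ p, ‖p.1 - p.2‖ₑ ^ 2 ∂η = ⊤
  · rw [hC]; exact le_top
  have hP := posSemidef_P hQ hQf hR hlam hpen (t + 1)
  have hD := hpen (t + 1) (by omega) (by omega)
  have hu := S.isUnit_one_add_mul_Phi hR hlam hP hD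
  have hconv : ∀ p : EuclideanSpace ℝ (Fin k) × EuclideanSpace ℝ (Fin k),
      ‖p.1 - p.2‖ₑ ^ 2 = ENNReal.ofReal (‖p.1 - p.2‖ ^ 2) := fun p => by
    rw [ENNReal.ofReal_pow (norm_nonneg _), ofReal_norm]
  simp only [hconv] at hC ⊢
  have hmeas : Measurable fun p : EuclideanSpace ℝ (Fin k) × EuclideanSpace ℝ (Fin k) =>
      ‖p.1 - p.2‖ ^ 2 := by fun_prop
  have hcost : Integrable (fun p : EuclideanSpace ℝ (Fin k) × EuclideanSpace ℝ (Fin k) =>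
      ‖p.1 - p.2‖ ^ 2) η :=
    (lintegral_ofReal_ne_top_iff_integrable hmeas.aestronglyMeasurable
      (Filter.Eventually.of_forall fun p => by positivity)).1 hC
  rw [← ofReal_integral_eq_lintegral_ofReal hcost (Filter.Eventually.of_forall fun p => by
    positivity)]
  refine ENNReal.ofReal_le_ofReal ?_
  rw [div_le_iff₀ hlam, ← valueFn_eq_saddle hN hQ hQf hR hlam hpen ht x]
  have i1 : Integrable (fun p : EuclideanSpace ℝ (Fin k) × EuclideanSpace ℝ (Fin k) =>
      S.valueFn lam (t + 1) (S.next (S.riccatiPolicy lam) t x p.1)) η := by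
    refine Integrable.comp_measurable (g := fun w => S.valueFn lam (t + 1)
      (S.next (S.riccatiPolicy lam) t x w)) ?_ measurable_fst
    rw [← Measure.fst, hη1]
    exact integrable_valueFn_next lam _ t (t + 1) x h2
  set h : EuclideanSpace ℝ (Fin k) → ℝ := fun w => S.saddleTerm lam (S.P lam (t + 1))
    (S.r lam (t + 1)) (S.constSeq lam (S.T - (t + 1))) (S.mean t).ofLp x w.ofLp with hh
  have hint := S.integrable_empirical hN t h
  rw [← hη2, Measure.snd] at hint
  have i2 : Integrable (fun p : EuclideanSpace ℝ (Fin k) × EuclideanSpace ℝ (Fin k) => h p.2) η :=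
    Integrable.comp_measurable (g := h) hint measurable_snd
  have e1 : ∫ w, S.valueFn lam (t + 1) (S.next (S.riccatiPolicy lam) t x w) ∂μ =
      ∫ p, S.valueFn lam (t + 1) (S.next (S.riccatiPolicy lam) t x p.1) ∂η := by
    rw [← hη1, Measure.fst, integral_map measurable_fst.aemeasurable]
    exact ((S.measurable_valueFn lam _).comp
      (measurable_next_right _ _ _)).aestronglyMeasurable
  have e2 : ∫ w, h w ∂S.empirical t = ∫ p, h p.2 ∂η := by
    rw [← hη2, Measure.snd, integral_map measurable_snd.aemeasurable hint.1]
  -- `le_saddleTerm` integrated against the coupling: the value term sees only the marginal `μ`, the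
  -- saddle term only the empirical one.
  have hmono : ∫ p, (S.valueFn lam (t + 1) (S.next (S.riccatiPolicy lam) t x p.1) -
      lam * ‖p.1 - p.2‖ ^ 2) ∂η ≤ ∫ p, h p.2 ∂η := by
    refine integral_mono (i1.sub (hcost.const_mul lam)) i2 fun p => ?_
    have := le_saddleTerm (S := S) (r := S.r lam (t + 1)) (wb := (S.mean t).ofLp)
      (s := S.constSeq lam (S.T - (t + 1))) hlam (PosSemidef.transpose_eq hP) hu hD x
      p.2.ofLp p.1.ofLp
    simp only [norm_sub_sq_eq, valueFn, next, riccatiPolicy_act]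
    exact this
  rw [integral_sub i1 (hcost.const_mul lam), integral_const_mul] at hmono
  rw [e1, e2]
  linarith

/-- Optimality of the Riccati input at one stage, against opponents with finite second moment. -/
lemma stage_upper (hN : 0 < N) (hQ : S.Q.PosSemidef) (hQf : S.Qf.PosSemidef)
    (hR : S.R.PosDef) {lam : ℝ} (hlam : 0 < lam) (hpen : S.PenaltyCondition lam) {t : ℕ}
    (ht : t < S.T) (x : Fin n → ℝ) {μ : Measure (EuclideanSpace ℝ (Fin k))}
    [IsProbabilityMeasure μ] (h2 : ∫⁻ w, ‖w‖ₑ ^ 2 ∂μ < ⊤) :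
    ((S.stageCost x ((S.riccatiPolicy lam).act t x) : ℝ) : EReal) -
      (lam : EReal) * ((wasserstein2 μ (S.empirical t) ^ 2 : ℝ≥0∞) : EReal) ≤
    ((S.valueFn lam t x -
      ∫ w, S.valueFn lam (t + 1) (S.next (S.riccatiPolicy lam) t x w) ∂μ : ℝ) : EReal) := by
  have h := le_wasserstein2_sq fun η h1 h2' =>
    stage_upper_coupling hN hQ hQf hR hlam hpen ht x h2 (η := η) h1 h2'
  generalize wasserstein2 μ (S.empirical t) ^ 2 = W at h
  rcases eq_or_ne W ⊤ with rfl | hW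
  · rw [EReal.coe_ennreal_top, EReal.coe_mul_top_of_pos hlam, EReal.sub_top]
    exact bot_le
  · rw [← EReal.coe_ennreal_toReal hW, ← EReal.coe_mul, ← EReal.coe_sub, EReal.coe_le_coe_iff]
    rw [ENNReal.ofReal_le_iff_le_toReal hW, div_le_iff₀ hlam] at h
    linarith

/-- A distribution without second moment is at infinite distance from the empirical one. -/
lemma wasserstein2_eq_top (hN : 0 < N) (t : ℕ) {μ : Measure (EuclideanSpace ℝ (Fin k))}
    (h2 : ¬ ∫⁻ w, ‖w‖ₑ ^ 2 ∂μ < ⊤) : wasserstein2 μ (S.empirical t) ^ 2 = ⊤ := by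
  rw [← top_le_iff]
  refine le_wasserstein2_sq fun η hη1 hη2 => ?_
  by_contra hC
  have hC' : ∫⁻ p, ‖p.1 - p.2‖ₑ ^ 2 ∂η < ⊤ := lt_of_not_ge hC
  apply h2
  -- At finite transport cost, `p.1 = (p.1 - p.2) + p.2` is a sum of two square-integrable maps, the
  -- second because the empirical marginal has finite support.
  have m1 : MemLp (fun p : EuclideanSpace ℝ (Fin k) × EuclideanSpace ℝ (Fin k) => p.1 - p.2)
      2 η := by
    refine ⟨(measurable_fst.sub measurable_snd).aestronglyMeasurable, ?_⟩
    rw [eLpNorm_lt_top_iff_lintegral_rpow_enorm_lt_top two_ne_zero ENNReal.ofNat_ne_top]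
    simpa using hC'
  have m2 : MemLp (fun p : EuclideanSpace ℝ (Fin k) × EuclideanSpace ℝ (Fin k) => p.2) 2 η := by
    have : MemLp (fun w : EuclideanSpace ℝ (Fin k) => w) 2 (η.map Prod.snd) := by
      rw [← Measure.snd, hη2]
      refine (memLp_two_iff_integrable_sq_norm measurable_id.aestronglyMeasurable).2 ?_
      exact S.integrable_empirical hN t _
    exact this.comp_measurePreserving (measurable_snd.measurePreserving η)
  have m3 := second_moment_of_memLp (m1.add m2)
  simp only [Pi.add_apply, sub_add_cancel] at m3
  rwa [← hη1, Measure.fst, lintegral_map (by fun_prop) measurable_fst]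

end Problem
end WassersteinControl
end

/-! ### Verification over the horizon and the duality bound -/

noncomputable section

namespace WassersteinControl
namespace Problem

variable {n m k N : ℕ} {S : Problem n m k N}

/-- Summation by parts: replacing each stage cost by `v_t(x_t) - E[v_{t+1}(x_{t+1}) | x_t]` turns
the total cost into the compensated sum. The stage inequalities can thus be compared pathwise before
any expectation is taken. -/
lemma sum_stage_add_terminal (π : Policy n m) (γ : Opponent n k) (v : ℕ → (Fin n → ℝ) → ℝ) (T : ℕ)
    (ξ : ℕ → Fin n → ℝ) :
    v T (ξ T) + ∑ t ∈ Finset.range T, (v t (ξ t) - ∫ y, v (t + 1) y ∂S.step π γ t (ξ t)) =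
      S.compensated π γ v T ξ := by
  induction T with
  | zero => simp [compensated]
  | succ T ih =>
    have : S.compensated π γ v (T + 1) ξ = S.compensated π γ v T ξ +
        (v (T + 1) (ξ (T + 1)) - ∫ y, v (T + 1) y ∂S.step π γ T (ξ T)) := by
      simp only [compensated, Finset.sum_range_succ, add_assoc]
    rw [this, ← ih, Finset.sum_range_succ]
    ring

lemma coe_sum_real {ι : Type*} (s : Finset ι) (f : ι → ℝ) :
    ((∑ i ∈ s, f i : ℝ) : EReal) = ∑ i ∈ s, ((f i : ℝ) : EReal) := by
  classical
  induction s using Finset.induction_on with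
  | empty => simp
  | insert a s ha ih => rw [Finset.sum_insert ha, Finset.sum_insert ha, EReal.coe_add, ih]

/-- The total penalized cost along a trajectory. -/
def penalizedTotal (S : Problem n m k N) (lam : ℝ) (π : Policy n m) (γ : Opponent n k)
    (ξ : ℕ → Fin n → ℝ) : EReal :=
  ((ξ S.T ⬝ᵥ S.Qf *ᵥ ξ S.T : ℝ) : EReal) +
      ∑ t ∈ Finset.range S.T, (((S.stageCost (ξ t) (π.act t (ξ t)) : ℝ) : EReal) -
        (lam : EReal) * ((wasserstein2 (γ.dist t (ξ t)) (S.empirical t) ^ 2 : ℝ≥0∞) : EReal))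

lemma measurableSet_second_moment (γ : Opponent n k) (t : ℕ) :
    MeasurableSet {x : Fin n → ℝ | ∫⁻ w, ‖w‖ₑ ^ 2 ∂γ.dist t x < ⊤} := by
  have : Measurable fun x : Fin n → ℝ => ∫⁻ w, ‖w‖ₑ ^ 2 ∂γ.dist t x :=
    Measurable.lintegral_kernel (by fun_prop)
  exact this measurableSet_Iio

/-- On trajectories along which all disturbance laws have second moments, `stage_upper` bounds the
total by the compensated sum `M`; elsewhere the total is `-∞`. -/
lemma extExpectation_penalizedTotal_le (hN : 0 < N) (hQ : S.Q.PosSemidef)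
    (hQf : S.Qf.PosSemidef) (hR : S.R.PosDef) {lam : ℝ} (hlam : 0 < lam)
    (hpen : S.PenaltyCondition lam) (γ : Opponent n k) (x : Fin n → ℝ) :
    extExpectation (S.law (S.riccatiPolicy lam) γ x)
      (S.penalizedTotal lam (S.riccatiPolicy lam) γ) ≤ ((S.valueFn lam 0 x : ℝ) : EReal) := by
  set π := S.riccatiPolicy lam with hπ
  set good : Set (ℕ → Fin n → ℝ) :=
    {ξ | ∀ t < S.T, ∫⁻ w, ‖w‖ₑ ^ 2 ∂γ.dist t (ξ t) < ⊤} with hgood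
  have hgm : MeasurableSet good := by
    have : good = ⋂ t : ℕ, ⋂ _ : t < S.T, (fun ξ : ℕ → Fin n → ℝ => ξ t) ⁻¹'
        {x : Fin n → ℝ | ∫⁻ w, ‖w‖ₑ ^ 2 ∂γ.dist t x < ⊤} := by
      ext ξ; simp [hgood]
    rw [this]
    exact MeasurableSet.iInter fun t => MeasurableSet.iInter fun _ =>
      (measurable_pi_apply t) (measurableSet_second_moment γ t)
  set M := S.compensated π γ (S.valueFn lam) S.T with hM
  have hMm : Measurable M := S.measurable_compensated π γ (S.measurable_valueFn lam) S.T
  have hle : ∀ ξ ∈ good, S.penalizedTotal lam π γ ξ ≤ (M ξ : EReal) := by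
    intro ξ hξ
    rw [hM, ← sum_stage_add_terminal, EReal.coe_add, coe_sum_real, valueFn_terminal]
    refine add_le_add le_rfl (Finset.sum_le_sum fun t ht => ?_)
    have ht' := Finset.mem_range.1 ht
    have := γ.isMarkov t
    rw [integral_step _ _ _ _ (S.measurable_valueFn lam _)]
    exact stage_upper hN hQ hQf hR hlam hpen ht' (ξ t) (hξ t ht')
  have hbot : ∀ ξ ∉ good, S.penalizedTotal lam π γ ξ = ⊥ := by
    intro ξ hξ
    simp only [hgood, Set.mem_ofPred_eq, not_forall] at hξ
    obtain ⟨t, ht, hξt⟩ := hξ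
    rw [penalizedTotal, ← Finset.add_sum_erase _ _ (Finset.mem_range.2 ht),
      wasserstein2_eq_top hN t hξt, EReal.coe_ennreal_top, EReal.coe_mul_top_of_pos hlam,
      EReal.sub_top, EReal.bot_add, EReal.add_bot]
  classical
  -- A measurable minorant of the negative part of the total, whose own measurability is not
  -- established.
  set L : (ℕ → Fin n → ℝ) → ℝ≥0∞ := fun ξ => if ξ ∈ good then ENNReal.ofReal (-M ξ) else ⊤ with hL
  have hLm : Measurable L := Measurable.ite hgm hMm.neg.ennreal_ofReal measurable_const
  have hLle : ∀ ξ, L ξ ≤ (-S.penalizedTotal lam π γ ξ).toENNReal := by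
    intro ξ
    by_cases hξ : ξ ∈ good
    · simp only [hL, if_pos hξ]
      have := EReal.toENNReal_le_toENNReal (EReal.neg_le_neg_iff.2 (hle ξ hξ))
      simpa [← EReal.coe_neg] using this
    · rw [hbot ξ hξ]; simp
  -- If `L` has infinite integral, the expectation is `-∞` by convention. Otherwise almost every
  -- trajectory is good and `M` has an integrable negative part.
  by_cases hLint : ∫⁻ ξ, L ξ ∂S.law π γ x = ⊤
  · rw [extExpectation_eq_bot (top_le_iff.1 (hLint ▸ lintegral_mono hLle))]
    exact bot_le
  have hgae : ∀ᵐ ξ ∂S.law π γ x, ξ ∈ good := by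
    filter_upwards [ae_lt_top hLm hLint] with ξ hξ
    by_contra h
    simp [hL, h] at hξ
  have hneg : ∫⁻ ξ, ENNReal.ofReal (-M ξ) ∂S.law π γ x ≠ ⊤ := by
    rw [lintegral_congr_ae (g := L)]
    · exact hLint
    · filter_upwards [hgae] with ξ hξ
      simp [hL, hξ]
  have hint : ∀ t < S.T, ∀ᵐ ξ ∂S.law π γ x,
      Integrable (S.valueFn lam (t + 1)) (S.step π γ t (ξ t)) := by
    intro t ht
    filter_upwards [hgae] with ξ hξ
    have := γ.isMarkov t
    rw [step_apply, integrable_map_measure (S.measurable_valueFn lam _).aestronglyMeasurable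
      (measurable_next_right _ _ _).aemeasurable]
    exact integrable_valueFn_next lam π t (t + 1) (ξ t) (hξ t ht)
  obtain ⟨hI, hmean⟩ := S.integral_compensated π γ (S.measurable_valueFn lam) x S.T hint hneg
  calc _ ≤ extExpectation (S.law π γ x) (fun ξ => (M ξ : EReal)) :=
        extExpectation_mono (hgae.mono hle)
    _ = _ := by rw [extExpectation_of_integrable hI, hmean]

/-- The worst-case opponent: it moves each sample to the saddle point disturbance. -/
def worstOpponent (S : Problem n m k N) (hN : 0 < N) (lam : ℝ) : Opponent n k where
  dist t := (Kernel.id ×ₖ Kernel.const _ (S.empirical t)).map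
    fun p => S.stageSaddle lam t p.1 p.2
  isMarkov t := by
    have := S.isProbabilityMeasure_empirical hN t
    exact Kernel.IsMarkovKernel.map _ (continuous_stageSaddle lam t).measurable

lemma measurable_stageSaddle_right (lam : ℝ) (t : ℕ) (x : Fin n → ℝ) :
    Measurable (S.stageSaddle lam t x) := by
  refine Continuous.measurable ?_
  have h : Continuous fun w => S.stageSaddle lam t x w := by
    unfold stageSaddle saddleDisturbance spread
    fun_prop
  exact h

lemma worstOpponent_dist (hN : 0 < N) (lam : ℝ) (t : ℕ) (x : Fin n → ℝ) :
    (S.worstOpponent hN lam).dist t x = (S.empirical t).map (S.stageSaddle lam t x) := by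
  have := S.isProbabilityMeasure_empirical hN t
  have hm := (continuous_stageSaddle (S := S) lam t).measurable
  change (Kernel.map _ _) x = _
  rw [Kernel.map_apply _ hm, Kernel.prod_apply, Kernel.id_apply, Kernel.const_apply,
    Measure.dirac_prod, Measure.map_map hm measurable_prodMk_left]
  rfl

/-- The coupling pairs each displaced sample with its origin. It need not be optimal: the penalty is
subtracted, so an upper bound suffices for `stage_lower`. -/
lemma wasserstein2_worstOpponent_le (hN : 0 < N) (lam : ℝ) (t : ℕ) (x : Fin n → ℝ) :
    wasserstein2 ((S.worstOpponent hN lam).dist t x) (S.empirical t) ^ 2 ≤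
      ENNReal.ofReal (∫ w, ‖S.stageSaddle lam t x w - w‖ ^ 2 ∂S.empirical t) := by
  have hm := measurable_stageSaddle_right (S := S) lam t x
  have hm2 : Measurable fun w => (S.stageSaddle lam t x w, w) := hm.prodMk measurable_id
  refine (wasserstein2_sq_le (η := (S.empirical t).map fun w => (S.stageSaddle lam t x w, w))
    ?_ ?_).trans_eq ?_
  · rw [worstOpponent_dist, Measure.fst, Measure.map_map measurable_fst hm2]; rfl
  · rw [Measure.snd, Measure.map_map measurable_snd hm2]
    exact Measure.map_id
  · rw [lintegral_map (by fun_prop) hm2, ofReal_integral_eq_lintegral_ofReal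
      (S.integrable_empirical hN t _) (Filter.Eventually.of_forall fun p => by positivity)]
    refine lintegral_congr fun w => ?_
    rw [ENNReal.ofReal_pow (norm_nonneg _), ofReal_norm]

/-- Against the worst-case opponent no input does better than the saddle value. -/
lemma stage_lower (hN : 0 < N) (hQ : S.Q.PosSemidef) (hQf : S.Qf.PosSemidef)
    (hR : S.R.PosDef) {lam : ℝ} (hlam : 0 < lam) (hpen : S.PenaltyCondition lam) {t : ℕ}
    (ht : t < S.T) (π : Policy n m) (x : Fin n → ℝ) :
    ((S.valueFn lam t x -
      ∫ y, S.valueFn lam (t + 1) y ∂S.step π (S.worstOpponent hN lam) t x : ℝ) : EReal) ≤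
    ((S.stageCost x (π.act t x) : ℝ) : EReal) - (lam : EReal) *
      ((wasserstein2 ((S.worstOpponent hN lam).dist t x) (S.empirical t) ^ 2 : ℝ≥0∞) : EReal) := by
  have hP := posSemidef_P hQ hQf hR hlam hpen (t + 1)
  have hu := S.isUnit_one_add_mul_Phi hR hlam hP (hpen (t + 1) (by omega) (by omega))
  have hW := wasserstein2_worstOpponent_le (S := S) hN lam t x
  set W := wasserstein2 ((S.worstOpponent hN lam).dist t x) (S.empirical t) ^ 2
  have hWtop : W ≠ ⊤ := ne_top_of_le_ne_top ENNReal.ofReal_ne_top hW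
  have hWr : W.toReal ≤ ∫ w, ‖S.stageSaddle lam t x w - w‖ ^ 2 ∂S.empirical t :=
    ENNReal.toReal_le_of_le_ofReal (integral_nonneg fun w => by positivity) hW
  rw [← EReal.coe_ennreal_toReal hWtop, ← EReal.coe_mul, ← EReal.coe_sub, EReal.coe_le_coe_iff]
  have hint : ∫ y, S.valueFn lam (t + 1) y ∂S.step π (S.worstOpponent hN lam) t x =
      ∫ w, S.valueFn lam (t + 1) (S.next π t x (S.stageSaddle lam t x w)) ∂S.empirical t := by
    rw [integral_step _ _ _ _ (S.measurable_valueFn lam _), worstOpponent_dist,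
      integral_map (measurable_stageSaddle_right lam t x).aemeasurable]
    exact ((S.measurable_valueFn lam _).comp
      (measurable_next_right _ _ _)).aestronglyMeasurable
  have hsad := valueFn_eq_saddle hN hQ hQf hR hlam hpen ht x
  rw [riccatiPolicy_act, stageCost] at hsad
  have hpt := fun i => saddleTerm_le (S := S) (r := S.r lam (t + 1)) (wb := (S.mean t).ofLp)
    (s := S.constSeq lam (S.T - (t + 1))) hR hP hu x (π.act t x) (S.sample t i).ofLp
  have hsum := Finset.sum_le_sum fun i (_ : i ∈ Finset.univ) => hpt i
  have hspread : ∑ i, S.spread lam (S.P lam (t + 1)) (S.mean t).ofLp (S.sample t i).ofLp = 0 := by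
    simp only [spread]
    rw [← Finset.smul_sum, ← Matrix.mulVec_sum, sum_sub_mean hN (S.mean_ofLp t)]
    simp
  -- The input sees the state but not the sample, so `d` is common to all `i` and the linear term of
  -- `saddleTerm_le` sums to zero.
  have hlin : ∀ d : Fin m → ℝ, ∑ i, 2 * (d ⬝ᵥ S.Bᵀ *ᵥ S.P lam (t + 1) *ᵥ S.Xi *ᵥ
      S.spread lam (S.P lam (t + 1)) (S.mean t).ofLp (S.sample t i).ofLp) = 0 := fun d => by
    rw [← Finset.mul_sum, ← dotProduct_sum, ← Matrix.mulVec_sum, ← Matrix.mulVec_sum,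
      ← Matrix.mulVec_sum, hspread]
    simp
  have hN' : (0 : ℝ) < N := by exact_mod_cast hN
  rw [hint, stageCost]
  rw [S.integral_empirical, smul_eq_mul] at hsad hWr ⊢
  simp only [norm_sub_sq_eq, stageSaddle] at hWr
  rw [Finset.sum_add_distrib, Finset.sum_add_distrib, hlin, Finset.sum_add_distrib,
    Finset.sum_sub_distrib, ← Finset.mul_sum] at hsum
  simp only [Finset.sum_const, Finset.card_univ, Fintype.card_fin, nsmul_eq_mul] at hsum
  have h1 := mul_le_mul_of_nonneg_left hsum (inv_nonneg.2 hN'.le)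
  have h2 := mul_le_mul_of_nonneg_left hWr hlam.le
  simp only [valueFn, next, stageSaddle] at hsad ⊢
  field_simp at h1 h2 hsad ⊢
  nlinarith

/-- Each state has at most `N` successors under this opponent. Every measurable function of `x_t` is
then integrable, however fast the policy grows. -/
lemma law_finite_support (hN : 0 < N) (lam : ℝ) (π : Policy n m) (x : Fin n → ℝ) (t : ℕ) :
    ∃ s : Finset (Fin n → ℝ), ∀ᵐ ξ ∂S.law π (S.worstOpponent hN lam) x, ξ t ∈ s := by
  classical
  induction t with
  | zero =>
    refine ⟨{x}, ?_⟩
    filter_upwards [S.law_zero π (S.worstOpponent hN lam) x] with ξ hξ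
    simp [hξ]
  | succ t ih =>
    obtain ⟨s, hs⟩ := ih
    set s' : Finset (Fin n → ℝ) := (s ×ˢ (Finset.univ : Finset (Fin N))).image fun p =>
      S.next π t p.1 (S.stageSaddle lam t p.1 (S.sample t p.2)) with hs'
    refine ⟨s', ?_⟩
    have hms : MeasurableSet ((s' : Set (Fin n → ℝ))ᶜ) := s'.measurableSet.compl
    have hf : Measurable fun p : (ℕ → Fin n → ℝ) × (Fin n → ℝ) =>
        ((s' : Set (Fin n → ℝ))ᶜ).indicator (fun _ => (1 : ℝ≥0∞)) p.2 :=
      (measurable_const.indicator hms).comp measurable_snd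
    have h := S.lintegral_law_adapted π (S.worstOpponent hN lam) x t hf (fun _ _ _ _ => rfl)
    have h0 : ∫⁻ ξ, ∫⁻ y, ((s' : Set (Fin n → ℝ))ᶜ).indicator (fun _ => (1 : ℝ≥0∞)) y
        ∂S.step π (S.worstOpponent hN lam) t (ξ t) ∂S.law π (S.worstOpponent hN lam) x = 0 := by
      rw [lintegral_congr_ae (g := fun _ => 0), lintegral_zero]
      filter_upwards [hs] with ξ hξ
      have hmn := measurable_next_right (S := S) π t (ξ t)
      have hmw := measurable_stageSaddle_right (S := S) lam t (ξ t)
      rw [lintegral_indicator_const hms, one_mul, step_apply, worstOpponent_dist,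
        Measure.map_map hmn hmw, Measure.map_apply (hmn.comp hmw) hms, empirical]
      simp only [Measure.smul_apply, Measure.finsetSum_apply, smul_eq_mul, mul_eq_zero]
      right
      refine Finset.sum_eq_zero fun i _ => ?_
      rw [Measure.dirac_apply' _ ((hmn.comp hmw) hms), Set.indicator_of_notMem]
      simp only [Set.mem_preimage, Set.mem_compl_iff, not_not, Finset.mem_coe, hs',
        Finset.mem_image]
      exact ⟨(ξ t, i), Finset.mem_product.2 ⟨hξ, Finset.mem_univ _⟩, rfl⟩
    rw [h0] at h
    have h1 := (lintegral_eq_zero_iff (hf.comp (measurable_id.prodMk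
      (measurable_pi_apply (t + 1))))).1 h
    filter_upwards [h1] with ξ hξ
    by_contra hn
    simp [hn] at hξ

lemma integrable_law_worst (hN : 0 < N) (lam : ℝ) (π : Policy n m) (x : Fin n → ℝ) (t : ℕ)
    {f : (Fin n → ℝ) → ℝ} (hf : Measurable f) :
    Integrable (fun ξ => f (ξ t)) (S.law π (S.worstOpponent hN lam) x) := by
  obtain ⟨s, hs⟩ := law_finite_support (S := S) hN lam π x t
  refine Integrable.of_bound (hf.comp (measurable_pi_apply t)).aestronglyMeasurable
    (∑ y ∈ s, ‖f y‖) ?_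
  filter_upwards [hs] with ξ hξ
  exact Finset.single_le_sum (f := fun y => ‖f y‖) (fun _ _ => norm_nonneg _) hξ

/-- The compensated sum is integrable by finite support, so its mean is exactly `v_0(x)`;
`stage_lower` puts it pathwise below the total. -/
lemma le_extExpectation_penalizedTotal (hN : 0 < N) (hQ : S.Q.PosSemidef)
    (hQf : S.Qf.PosSemidef) (hR : S.R.PosDef) {lam : ℝ} (hlam : 0 < lam)
    (hpen : S.PenaltyCondition lam) (π : Policy n m) (x : Fin n → ℝ) :
    ((S.valueFn lam 0 x : ℝ) : EReal) ≤
      extExpectation (S.law π (S.worstOpponent hN lam) x)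
        (S.penalizedTotal lam π (S.worstOpponent hN lam)) := by
  set γ := S.worstOpponent hN lam with hγ
  set M := S.compensated π γ (S.valueFn lam) S.T with hM
  have hMI : Integrable M (S.law π γ x) := by
    rw [hM]
    unfold compensated
    refine (integrable_law_worst hN lam π x 0 (S.measurable_valueFn lam 0)).add
      (integrable_finsetSum _ fun t _ => ?_)
    exact (integrable_law_worst hN lam π x (t + 1) (S.measurable_valueFn lam _)).sub
      (integrable_law_worst hN lam π x t
        (S.measurable_integral_step π γ (S.measurable_valueFn lam _) t))
  have hint : ∀ t < S.T, ∀ᵐ ξ ∂S.law π γ x,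
      Integrable (S.valueFn lam (t + 1)) (S.step π γ t (ξ t)) := by
    intro t _
    refine Filter.Eventually.of_forall fun ξ => ?_
    have hmn := measurable_next_right (S := S) π t (ξ t)
    have hmw := measurable_stageSaddle_right (S := S) lam t (ξ t)
    rw [step_apply, worstOpponent_dist, Measure.map_map hmn hmw,
      integrable_map_measure (S.measurable_valueFn lam _).aestronglyMeasurable
      (hmn.comp hmw).aemeasurable]
    exact S.integrable_empirical hN t _
  have hmean := (S.integral_compensated π γ (S.measurable_valueFn lam) x S.T hint
    hMI.neg.lintegral_lt_top.ne).2
  rw [← hmean, ← extExpectation_of_integrable hMI]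
  refine extExpectation_mono (Filter.Eventually.of_forall fun ξ => ?_)
  rw [hM, ← sum_stage_add_terminal, EReal.coe_add, coe_sum_real, valueFn_terminal]
  exact add_le_add le_rfl (Finset.sum_le_sum fun t ht =>
    stage_lower hN hQ hQf hR hlam hpen (Finset.mem_range.1 ht) π (ξ t))

/-- The number `v_0(x)/T` separates the two suprema: it is above every cost of the Riccati policy
and below the cost of any `π'` against the worst-case opponent. -/
lemma isOptimal_riccatiPolicy (hN : 0 < N) (hQ : S.Q.PosSemidef)
    (hQf : S.Qf.PosSemidef) (hR : S.R.PosDef) {lam : ℝ} (hlam : 0 < lam)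
    (hpen : S.PenaltyCondition lam) (x : Fin n → ℝ) :
    S.IsOptimal lam x (S.riccatiPolicy lam) := by
  intro π'
  have hT0 : (0 : EReal) ≤ (((S.T : ℝ)⁻¹ : ℝ) : EReal) := by
    exact_mod_cast inv_nonneg.2 (Nat.cast_nonneg S.T)
  refine (iSup_le fun γ => ?_).trans (le_iSup _ (S.worstOpponent hN lam))
  exact mul_le_mul_of_nonneg_left
    ((extExpectation_penalizedTotal_le hN hQ hQf hR hlam hpen γ x).trans
      (le_extExpectation_penalizedTotal hN hQ hQf hR hlam hpen π' x)) hT0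

/-- Pathwise the penalties total at most `T λθ²`, and the averaging factor `1/T` reduces this to
`λθ²`. Nonnegativity of the costs lets the constant leave the extended expectation. -/
lemma cost_le_penalizedCost (hT : 0 < S.T) (hQ : S.Q.PosSemidef) (hQf : S.Qf.PosSemidef)
    (hR : S.R.PosDef) {θ : ℝ} (hθ : 0 ≤ θ) {lam : ℝ} (hlam : 0 ≤ lam) (x : Fin n → ℝ)
    (π : Policy n m) {γ : Opponent n k} (hγ : γ ∈ S.ambiguity θ) :
    S.cost x π γ ≤ ((lam * θ ^ 2 : ℝ) : EReal) + S.penalizedCost lam x π γ := by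
  have hT' : (S.T : ℝ) ≠ 0 := by positivity
  have hT0 : (0 : EReal) ≤ (((S.T : ℝ)⁻¹ : ℝ) : EReal) := by
    exact_mod_cast inv_nonneg.2 (Nat.cast_nonneg S.T)
  set f : (ℕ → Fin n → ℝ) → ℝ := fun ξ => ξ S.T ⬝ᵥ S.Qf *ᵥ ξ S.T +
    ∑ t ∈ Finset.range S.T, S.stageCost (ξ t) (π.act t (ξ t)) with hf
  have hquad : ∀ {p : ℕ} (M : Matrix (Fin p) (Fin p) ℝ),
      Measurable fun v : Fin p → ℝ => v ⬝ᵥ M *ᵥ v := fun M =>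
    Continuous.measurable (by fun_prop)
  have hfm : Measurable f := by
    refine ((hquad S.Qf).comp (measurable_pi_apply S.T)).add
      (Finset.measurable_sum _ fun t _ => ?_)
    exact ((hquad S.Q).comp (measurable_pi_apply t)).add
      ((hquad S.R).comp ((π.measurable_act t).comp (measurable_pi_apply t)))
  have hf0 : ∀ ξ, 0 ≤ f ξ := fun ξ =>
    add_nonneg (PosSemidef.dot_nonneg hQf _) (Finset.sum_nonneg fun t _ =>
      add_nonneg (PosSemidef.dot_nonneg hQ _) (PosSemidef.dot_nonneg hR.posSemidef _))
  have hpt : ∀ ξ, ((f ξ - S.T * (lam * θ ^ 2) : ℝ) : EReal) ≤ S.penalizedTotal lam π γ ξ := by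
    intro ξ
    have e : f ξ - S.T * (lam * θ ^ 2) = ξ S.T ⬝ᵥ S.Qf *ᵥ ξ S.T +
        ∑ t ∈ Finset.range S.T, (S.stageCost (ξ t) (π.act t (ξ t)) - lam * θ ^ 2) := by
      rw [Finset.sum_sub_distrib, Finset.sum_const, Finset.card_range, nsmul_eq_mul, hf]
      ring
    rw [e, EReal.coe_add, coe_sum_real]
    refine add_le_add le_rfl (Finset.sum_le_sum fun t _ => ?_)
    have hW : wasserstein2 (γ.dist t (ξ t)) (S.empirical t) ^ 2 ≤ ENNReal.ofReal (θ ^ 2) := by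
      rw [ENNReal.ofReal_pow hθ]
      gcongr
      exact hγ t (ξ t)
    have hWtop := ne_top_of_le_ne_top ENNReal.ofReal_ne_top hW
    have hWr := ENNReal.toReal_le_of_le_ofReal (by positivity) hW
    rw [← EReal.coe_ennreal_toReal hWtop, ← EReal.coe_mul, ← EReal.coe_sub, EReal.coe_le_coe_iff]
    have := mul_le_mul_of_nonneg_left hWr hlam
    linarith
  have hcost : S.cost x π γ = (((S.T : ℝ)⁻¹ : ℝ) : EReal) *
      extExpectation (S.law π γ x) (fun ξ => (f ξ : EReal)) := by
    simp only [cost, hf, EReal.coe_add, coe_sum_real]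
  have hmain : extExpectation (S.law π γ x) (fun ξ => (f ξ : EReal)) ≤
      extExpectation (S.law π γ x) (S.penalizedTotal lam π γ) +
        ((S.T * (lam * θ ^ 2) : ℝ) : EReal) :=
    (extExpectation_le_sub_add hfm hf0 _).trans
      (add_le_add_left (extExpectation_mono (Filter.Eventually.of_forall hpt)) _)
  rw [hcost]
  refine (mul_le_mul_of_nonneg_left hmain hT0).trans_eq ?_
  rw [EReal.left_distrib_of_nonneg_of_ne_top hT0 (EReal.coe_ne_top _), ← EReal.coe_mul,
    inv_mul_cancel_left₀ hT', add_comm]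
  rfl

lemma iSup_cost_le (hT : 0 < S.T) (hQ : S.Q.PosSemidef) (hQf : S.Qf.PosSemidef)
    (hR : S.R.PosDef) {θ : ℝ} (hθ : 0 ≤ θ) {lam : ℝ} (hlam : 0 ≤ lam) (x : Fin n → ℝ)
    (π : Policy n m) (hπ : S.IsOptimal lam x π) :
    (⨆ γ ∈ S.ambiguity θ, S.cost x π γ) ≤ ((lam * θ ^ 2 : ℝ) : EReal) + S.value lam x := by
  refine iSup₂_le fun γ hγ => (cost_le_penalizedCost hT hQ hQf hR hθ hlam x π hγ).trans ?_
  exact add_le_add le_rfl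
    ((le_iSup (fun γ => S.penalizedCost lam x π γ) γ).trans (le_iInf hπ))

end Problem
end WassersteinControl
end

theorem mainTheorem7 {n m k N : ℕ} (hN : 0 < N) (S : WassersteinControl.Problem n m k N)
    (hT : 0 < S.T) (hQ : S.Q.PosSemidef) (hQf : S.Qf.PosSemidef) (hR : S.R.PosDef)
    (θ : ℝ) (hθ : 0 ≤ θ) (lam : ℝ) (hlam : 0 ≤ lam) :
    (∀ (x : Fin n → ℝ) (π : WassersteinControl.Policy n m), S.IsOptimal lam x π →
      (⨆ γ ∈ S.ambiguity θ, S.cost x π γ) ≤ ((lam * θ ^ 2 : ℝ) : EReal) + S.value lam x) ∧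
    (0 < lam → S.PenaltyCondition lam →
      ∀ x : Fin n → ℝ, S.IsOptimal lam x (S.riccatiPolicy lam) ∧
        (⨆ γ ∈ S.ambiguity θ, S.cost x (S.riccatiPolicy lam) γ) ≤
          ((lam * θ ^ 2 : ℝ) : EReal) + S.value lam x) := by
  refine ⟨fun x π hπ => S.iSup_cost_le hT hQ hQf hR hθ hlam x π hπ, fun hpos hpen x => ?_⟩
  have hopt := S.isOptimal_riccatiPolicy hN hQ hQf hR hpos hpen x
  exact ⟨hopt, S.iSup_cost_le hT hQ hQf hR hθ hlam x _ hopt⟩
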